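/- Let $n$ be a positive integer. Let $F_{n+1}$ be the set of maximal chains in the non-crossing partition lattice of type $A_n$, i.e. of sequences $w=(t_1,\dots,t_n)$ of transpositions in $S_{n+1}$ with $t_1t_2\cdots t_n=c=(1,2,\dots,n+1)$ (permutations are composed from right to left); the chain of $w$ is $1<t_1<t_1t_2<\dots<t_1\cdots t_n=c$. The Hurwitz graph has vertex set $F_{n+1}$, two chains being adjacent if they differ in exactly one element. Put $e=((1,2),(2,3),\dots,(n,n+1))$. The weak order $\mathrm{Weak}(F_{n+1})$ is defined by $u\le v$ if $u$ lies on a geodesic of the Hurwitz graph from $e$ to $v$; let $\max(F_{n+1})$ be its set of maximal elements. For $w=(t_1,\dots,t_n)\in F_{n+1}$ put $\sigma_j=t_jt_{j+1}\cdots t_n$ for $1\le j\le n$, and $\sigma_{n+1}=\mathrm{id}$. For each $1\le j\le n$ there is exactly one $i\in\{1,\dots,n\}$ with $\sigma_j(i)>\sigma_{j+1}(i)$; put $\phi_w(j)=i$. Then $\phi_w\in S_n$. Let $\mathrm{Inv}(w)=\{(i,j): 1\le i<j\le n,\ \phi_w^{-1}(i)>\phi_w^{-1}(j)\}$. For $(i,j)\in\mathrm{Inv}(w)$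 write $s=t_{\phi_w^{-1}(j)}$ and $s'=t_{\phi_w^{-1}(i)}$. The pair $(i,j)$ is - a right inversion if $s=(a,c)$, $s'=(a,b)$ for some $a<b<c$, or $s=(a,d)$, $s'=(b,c)$ for some $a<b<c<d$; - a left inversion if $s=(b,c)$, $s'=(a,c)$ for some $a<b<c$, or $s=(b,c)$, $s'=(a,d)$ for some $a<b<c<d$; - a neutral inversion if $s=(c,d)$, $s'=(a,b)$ for some $a<b<c<d$. Let $\mathrm{inv}_R(w)$ and $\mathrm{inv}_L(w)$ be the numbers of right and of left inversions of $w$, and let $\mathrm{inv}_{LN}(w)$ be the number of inversions of $w$ that are left or neutral. Define the $(q,t)$-Catalan numbers by $\widetilde C_0(q,t)=1$ and $$\widetilde C_{m+1}(q,t)=\sum_{k=0}^{m} q^k t^{m-k}\,\widetilde C_k(q,t)\,\widetilde C_{m-k}(q,t)\qquad(m\ge 0),$$ and the Carlitz–Riordan $q$-Catalan numbers by $C_0(q)=1$ and $$C_{m+1}(q)=\sum_{k=0}^{m} q^{(k+1)(m-k)}\,C_k(q)\,C_{m-k}(q)\qquad(m\ge 0).$$ Then $$\sum_{w\in\max(F_{n+1})}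 q^{\mathrm{inv}_R(w)}\,t^{\mathrm{inv}_L(w)}=\widetilde C_n(q,t),$$ and consequently $$\sum_{w\in\max(F_{n+1})} q^{\mathrm{inv}_R(w)}=q^{\binom n2}\,C_n(q^{-1}),\qquad\text{equivalently}\qquad \sum_{w\in\max(F_{n+1})} q^{\mathrm{inv}_{LN}(w)}=C_n(q).$$ Here $q$ and $t$ may be taken to be arbitrary elements of a commutative ring (in particular indeterminates), with $q$ invertible wherever $q^{-1}$ appears. -/

import Mathlib

/-- The set `F_{n+1}` of maximal chains in the non-crossing partition lattice `NC(n+1)`, each chain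
`1 < t₁ < t₁t₂ < ⋯ < t₁⋯tₙ = c` being written as the factorization `(t₁, …, tₙ)` of the long cycle
`c = (1,2,…,n+1)` into the minimal number `n` of transpositions.  The letters `1, …, n+1` are
`0, …, n` in `Fin (n+1)`, so that `c = finRotate (n+1)`, and products of permutations are composed
from right to left. -/
@[ext]
structure HurwitzWord (n : ℕ) where
  letter : Fin n → Equiv.Perm (Fin (n + 1))
  isSwap : ∀ j, (letter j).IsSwap
  prod_eq : (List.ofFn letter).prod = finRotate (n + 1)

/-- The `(q,t)`-Catalan numbers: `C̃_0 = 1`,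
`C̃_{n+1}(q,t) = ∑_{k=0}^n q^k t^{n-k} C̃_k(q,t) C̃_{n-k}(q,t)`. -/
def qtCatalan {R : Type*} [CommRing R] (q t : R) : ℕ → R
  | 0 => 1
  | n + 1 => ∑ k : Fin (n + 1),
      q ^ (k : ℕ) * t ^ (n - k) * qtCatalan q t k * qtCatalan q t (n - k)

/-- The Carlitz–Riordan `q`-Catalan numbers: `C_0 = 1`,
`C_{n+1}(q) = ∑_{k=0}^n q^{(k+1)(n-k)} C_k(q) C_{n-k}(q)`. -/
def carlitzRiordan {R : Type*} [CommRing R] (q : R) : ℕ → R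
  | 0 => 1
  | n + 1 => ∑ k : Fin (n + 1),
      q ^ (((k : ℕ) + 1) * (n - k)) * carlitzRiordan q k * carlitzRiordan q (n - k)

namespace HurwitzWord

variable {n : ℕ}

noncomputable instance : Fintype (HurwitzWord n) :=
  have : Finite (HurwitzWord n) :=
    Finite.of_injective HurwitzWord.letter (fun _ _ h => HurwitzWord.ext h)
  Fintype.ofFinite _

/-! ### The Hurwitz graph and the weak order -/

/-- The element `t₁ t₂ ⋯ t_k` of rank `k` of the maximal chain of `w` (`0 ≤ k ≤ n`). -/
def chain (w : HurwitzWord n) (k : Fin (n + 1)) : Equiv.Perm (Fin (n + 1)) :=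
  ((List.ofFn w.letter).take k).prod

/-- The Hurwitz graph `G_T(n+1)`: two maximal chains are adjacent if they differ in exactly one
element. -/
def hurwitzGraph (n : ℕ) : SimpleGraph (HurwitzWord n) where
  Adj u v := ∃! k, u.chain k ≠ v.chain k
  symm := ⟨fun _ _ h => by simpa only [ne_comm] using h⟩
  loopless := ⟨fun _ h => by
    obtain ⟨_, hk, _⟩ := h
    exact hk rfl⟩

theorem prod_ofFn_swap (n : ℕ) :
    (List.ofFn fun i : Fin n => Equiv.swap i.castSucc i.succ).prod = finRotate (n + 1) := by
  induction n with
  | zero =>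
    simp
    rfl
  | succ n ih =>
    have key : ∀ (l : List (Fin (n + 1) × Fin (n + 1))),
        (l.map fun p => Equiv.swap p.1.succ p.2.succ).prod =
          Equiv.Perm.decomposeFin.symm (0, (l.map fun p => Equiv.swap p.1 p.2).prod) := by
      intro l
      induction l with
      | nil => exact (Equiv.Perm.decomposeFin_symm_of_one 0).symm ▸ (Equiv.swap_self _).symm
      | cons p l ihl =>
        rw [List.map_cons, List.prod_cons, ihl, List.map_cons, List.prod_cons]
        refine Equiv.ext fun x => ?_
        refine Fin.cases ?_ (fun i => ?_) x
        · rw [Equiv.Perm.mul_apply, Equiv.Perm.decomposeFin_symm_apply_zero,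
            Equiv.Perm.decomposeFin_symm_apply_zero,
            Equiv.swap_apply_of_ne_of_ne (Fin.succ_ne_zero _).symm (Fin.succ_ne_zero _).symm]
        · simp only [Equiv.Perm.mul_apply, Equiv.Perm.decomposeFin_symm_apply_succ,
            Equiv.swap_self, Equiv.refl_apply]
          exact (Fin.succ_injective _).swap_apply _ _ _
    have h := key (List.ofFn fun i : Fin n => (i.castSucc, i.succ))
    rw [List.map_ofFn, List.map_ofFn] at h
    simp only [Function.comp_def] at h
    rw [ih] at h
    rw [List.ofFn_succ, List.prod_cons, finRotate_succ_eq_decomposeFin]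
    simp only [Fin.castSucc_zero, Fin.succ_zero_eq_one, ← Fin.succ_castSucc]
    rw [h]
    refine Equiv.ext fun x => ?_
    refine Fin.cases ?_ (fun i => ?_) x
    · simp
    · simp

/-- The base point `e = ((1,2), (2,3), …, (n,n+1))`. -/
def base (n : ℕ) : HurwitzWord n where
  letter i := Equiv.swap i.castSucc i.succ
  isSwap _ := ⟨_, _, Fin.castSucc_lt_succ.ne, rfl⟩
  prod_eq := prod_ofFn_swap n

/-- The weak order on `F_{n+1}`: `u ≤ v` if `u` lies on a geodesic of the Hurwitz graph from `e`
to `v`. -/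
instance : LE (HurwitzWord n) where
  le u v := ∃ p : (hurwitzGraph n).Walk (base n) v,
    p.length = (hurwitzGraph n).dist (base n) v ∧ u ∈ p.support

/-! ### The map `φ` to permutations -/

/-- The partial product `σ_j = t_j t_{j+1} ⋯ t_{n-1}` of a word with 0-based letters
`t_0, …, t_{n-1}`; `σ_n` is the identity. -/
def suffix (w : HurwitzWord n) (j : ℕ) : Equiv.Perm (Fin (n + 1)) :=
  ((List.ofFn w.letter).drop j).prod

/-- `A_j = {i : σ_j(i) > σ_{j+1}(i)}`, where `i` ranges over all letters except the largest. -/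
def ascents (w : HurwitzWord n) (j : Fin n) : Set (Fin n) :=
  {i | w.suffix (j + 1) i.castSucc < w.suffix j i.castSucc}

theorem suffix_eq_mul (w : HurwitzWord n) (j : Fin n) :
    w.suffix j = w.letter j * w.suffix (j + 1) := by
  unfold suffix
  rw [List.drop_eq_getElem_cons (by simp), List.prod_cons]
  simp

theorem ascents_subsingleton (w : HurwitzWord n) (j : Fin n) : (w.ascents j).Subsingleton := by
  obtain ⟨a, b, hab, ht⟩ := w.isSwap j
  have key : ∀ i ∈ w.ascents j, w.suffix (j + 1) i.castSucc = min a b := by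
    intro i hi
    have hi' : w.suffix (j + 1) i.castSucc < w.suffix j i.castSucc := hi
    rw [suffix_eq_mul, Equiv.Perm.mul_apply, ht, Equiv.swap_apply_def] at hi'
    split_ifs at hi' with h1 h2
    · rw [h1] at hi' ⊢
      exact (min_eq_left hi'.le).symm
    · rw [h2] at hi' ⊢
      exact (min_eq_right hi'.le).symm
    · exact absurd hi' (lt_irrefl _)
  intro i hi i' hi'
  have h := (key i hi).trans (key i' hi').symm
  exact Fin.castSucc_injective n ((w.suffix (j + 1)).injective h)

theorem exists_mem_ascents (w : HurwitzWord n) (i : Fin n) : ∃ j, i ∈ w.ascents j := by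
  by_contra! h
  have step : ∀ m : ℕ, m ≤ n → w.suffix 0 i.castSucc ≤ w.suffix m i.castSucc := by
    intro m
    induction m with
    | zero => intro _; exact le_rfl
    | succ m ih =>
      intro hm
      exact (ih (by omega)).trans (not_lt.mp (h ⟨m, hm⟩))
  have h0 : w.suffix 0 i.castSucc = i.succ := by
    simp [suffix, w.prod_eq]
  have hn : w.suffix n i.castSucc = i.castSucc := by
    simp [suffix, List.drop_of_length_le]
  have := step n le_rfl
  rw [h0, hn] at this
  exact absurd this (not_le.mpr Fin.castSucc_lt_succ)

theorem exists_ascents_eq (w : HurwitzWord n) (j : Fin n) : ∃ i, w.ascents j = {i} := by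
  choose f hf using w.exists_mem_ascents
  have hinj : Function.Injective f := fun a b hab =>
    w.ascents_subsingleton (f a) (hf a) (hab ▸ hf b)
  obtain ⟨i, rfl⟩ := (Finite.injective_iff_surjective.mp hinj) j
  exact ⟨i, (w.ascents_subsingleton _).eq_singleton_of_mem (hf i)⟩

/-- `φ(w)(j) = i` if `A_j = {i}`. -/
noncomputable def phiFun (w : HurwitzWord n) (j : Fin n) : Fin n :=
  (w.exists_ascents_eq j).choose

theorem ascents_eq (w : HurwitzWord n) (j : Fin n) : w.ascents j = {w.phiFun j} :=
  (w.exists_ascents_eq j).choose_spec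

theorem phiFun_bijective (w : HurwitzWord n) : Function.Bijective w.phiFun := by
  refine Finite.surjective_iff_bijective.mp fun i => ?_
  obtain ⟨j, hj⟩ := w.exists_mem_ascents i
  rw [ascents_eq] at hj
  exact ⟨j, hj.symm⟩

/-- The map `φ : F_{n+1} → S_n`. -/
noncomputable def phi (w : HurwitzWord n) : Equiv.Perm (Fin n) :=
  Equiv.ofBijective w.phiFun w.phiFun_bijective

/-! ### Right, left and neutral inversions -/

/-- `Inv(w) = Inv(φ(w)) = {(i,j) : i < j, φ(w)⁻¹(i) > φ(w)⁻¹(j)}`. -/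
def inversions (w : HurwitzWord n) : Set (Fin n × Fin n) :=
  {p | p.1 < p.2 ∧ w.phi.symm p.2 < w.phi.symm p.1}

/-- The letter `t_{φ(w)⁻¹(i)}` of `w`. -/
noncomputable def letterAt (w : HurwitzWord n) (i : Fin n) : Equiv.Perm (Fin (n + 1)) :=
  w.letter (w.phi.symm i)

/-- The set of right inversions of `w`. -/
def invR (w : HurwitzWord n) : Set (Fin n × Fin n) :=
  {p ∈ w.inversions |
    (∃ a b c, a < b ∧ b < c ∧
      w.letterAt p.2 = Equiv.swap a c ∧ w.letterAt p.1 = Equiv.swap a b) ∨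
    (∃ a b c d, a < b ∧ b < c ∧ c < d ∧
      w.letterAt p.2 = Equiv.swap a d ∧ w.letterAt p.1 = Equiv.swap b c)}

/-- The set of left inversions of `w`. -/
def invL (w : HurwitzWord n) : Set (Fin n × Fin n) :=
  {p ∈ w.inversions |
    (∃ a b c, a < b ∧ b < c ∧
      w.letterAt p.2 = Equiv.swap b c ∧ w.letterAt p.1 = Equiv.swap a c) ∨
    (∃ a b c d, a < b ∧ b < c ∧ c < d ∧
      w.letterAt p.2 = Equiv.swap b c ∧ w.letterAt p.1 = Equiv.swap a d)}

/-- The set of neutral inversions of `w`. -/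
def invN (w : HurwitzWord n) : Set (Fin n × Fin n) :=
  {p ∈ w.inversions |
    ∃ a b c d, a < b ∧ b < c ∧ c < d ∧
      w.letterAt p.2 = Equiv.swap c d ∧ w.letterAt p.1 = Equiv.swap a b}

open Classical in
/-- The set `max(F_{n+1})` of maximal elements of the weak order. -/
noncomputable def maxElements (n : ℕ) : Finset (HurwitzWord n) :=
  Finset.univ.filter fun w => IsMax w

end HurwitzWord

/-! ### Inversion numbers of permutations -/

/-- The set of pairs of positions at which a permutation of `Fin n` has an inversion. -/
def Equiv.Perm.posInversions {n : ℕ} (π : Equiv.Perm (Fin n)) : Finset (Fin n × Fin n) :=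
  Finset.univ.filter fun p => p.1 < p.2 ∧ π p.2 < π p.1

theorem Equiv.Perm.mem_posInversions {n : ℕ} {π : Equiv.Perm (Fin n)} {p : Fin n × Fin n} :
    p ∈ π.posInversions ↔ p.1 < p.2 ∧ π p.2 < π p.1 := by
  simp [posInversions]

theorem Equiv.Perm.posInversions_one (n : ℕ) :
    (1 : Equiv.Perm (Fin n)).posInversions = ∅ := by
  ext p
  simp only [mem_posInversions, Equiv.Perm.coe_one, id, Finset.notMem_empty, iff_false]
  exact fun h => lt_asymm h.1 h.2

theorem Equiv.Perm.card_posInversions_mul_swap_of_lt {n : ℕ} (π : Equiv.Perm (Fin n))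
    {k l : Fin n} (hkl : (l : ℕ) = k + 1) (h : π k < π l) :
    (π * Equiv.swap k l).posInversions.card = π.posInversions.card + 1 := by
  have hlt : k < l := by rw [Fin.lt_def]; omega
  have hne : k ≠ l := hlt.ne
  -- An adjacent swap reverses the order of no pair except (k, l), so it carries the old inversions
  -- injectively to new ones, and (k, l) is the only addition.
  have mono : ∀ i j : Fin n, i < j → (i, j) ≠ (k, l) → Equiv.swap k l i < Equiv.swap k l j := by
    intro i j hij hne'
    have hne2 : ¬ (i = k ∧ j = l) := fun h => hne' (by rw [h.1, h.2])
    rw [Equiv.swap_apply_def, Equiv.swap_apply_def]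
    simp only [Fin.ext_iff, Fin.lt_def] at *
    split_ifs <;> omega
  have hmem : (k, l) ∉ π.posInversions.image (Prod.map (Equiv.swap k l) (Equiv.swap k l)) := by
    simp only [Finset.mem_image, not_exists, not_and, Prod.forall, mem_posInversions,
      Prod.map_apply, Prod.mk.injEq]
    rintro i j ⟨hij, hπ⟩ h1 h2
    have hi : i = l := by simpa using congrArg (Equiv.swap k l) h1
    have hj : j = k := by simpa using congrArg (Equiv.swap k l) h2
    subst hi hj
    exact absurd hij (not_lt.mpr hlt.le)
  have heq : (π * Equiv.swap k l).posInversions =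
      insert (k, l) (π.posInversions.image (Prod.map (Equiv.swap k l) (Equiv.swap k l))) := by
    ext ⟨i, j⟩
    simp only [Finset.mem_image, Prod.exists, mem_posInversions, Finset.mem_insert,
      Prod.map_apply, Equiv.Perm.mul_apply]
    constructor
    · rintro ⟨hij, hπ⟩
      by_cases hc : (i, j) = (k, l)
      · exact Or.inl hc
      · exact Or.inr ⟨_, _, ⟨mono i j hij hc, hπ⟩, by simp⟩
    · rintro (hc | ⟨a, b, ⟨hab, hπ⟩, hc⟩)
      · obtain ⟨rfl, rfl⟩ := Prod.mk.inj hc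
        exact ⟨hlt, by simpa using h⟩
      · obtain ⟨rfl, rfl⟩ := Prod.mk.inj hc
        refine ⟨mono a b hab ?_, by simpa using hπ⟩
        intro hc
        obtain ⟨rfl, rfl⟩ := Prod.mk.inj hc
        exact absurd hπ (not_lt.mpr h.le)
  rw [heq, Finset.card_insert_of_notMem hmem, Finset.card_image_of_injective]
  exact (Equiv.injective _).prodMap (Equiv.injective _)

theorem Equiv.Perm.card_posInversions_mul_swap_of_gt {n : ℕ} (π : Equiv.Perm (Fin n))
    {k l : Fin n} (hkl : (l : ℕ) = k + 1) (h : π l < π k) :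
    (π * Equiv.swap k l).posInversions.card + 1 = π.posInversions.card := by
  have := (π * Equiv.swap k l).card_posInversions_mul_swap_of_lt hkl (by simpa using h)
  rw [mul_assoc, Equiv.swap_mul_self, mul_one] at this
  exact this.symm

theorem Equiv.Perm.card_posInversions_mul_swap_le {n : ℕ} (π : Equiv.Perm (Fin n))
    {k l : Fin n} (hkl : (l : ℕ) = k + 1) :
    (π * Equiv.swap k l).posInversions.card ≤ π.posInversions.card + 1 := by
  have hne : k ≠ l := by rw [Ne, Fin.ext_iff]; omega
  rcases lt_or_gt_of_ne (π.injective.ne hne) with h | h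
  · exact (π.card_posInversions_mul_swap_of_lt hkl h).le
  · have := π.card_posInversions_mul_swap_of_gt hkl h
    omega

theorem Fin.strictMono_of_lt_of_val_eq {n : ℕ} {α : Type*} [Preorder α] {f : Fin n → α}
    (h : ∀ k l : Fin n, (l : ℕ) = k + 1 → f k < f l) : StrictMono f := by
  cases n with
  | zero => exact fun i => i.elim0
  | succ n => exact Fin.strictMono_iff_lt_succ.mpr fun i => h _ _ (by simp)

theorem Equiv.Perm.eq_one_of_forall_lt {n : ℕ} {π : Equiv.Perm (Fin n)}
    (h : ∀ k l : Fin n, (l : ℕ) = k + 1 → π k < π l) : π = 1 := by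
  have hm := Fin.strictMono_of_lt_of_val_eq h
  have := Subsingleton.elim (hm.orderIsoOfSurjective π π.surjective) (OrderIso.refl _)
  ext i
  exact congrArg Fin.val (DFunLike.congr_fun this i)

theorem Equiv.Perm.eq_revPerm_of_forall_gt {n : ℕ} {π : Equiv.Perm (Fin n)}
    (h : ∀ k l : Fin n, (l : ℕ) = k + 1 → π l < π k) : π = Fin.revPerm := by
  have : Fin.revPerm * π = 1 := eq_one_of_forall_lt fun k l hkl => by
    simpa using h k l hkl
  have h2 := inv_eq_of_mul_eq_one_right this
  rw [← h2]
  exact Fin.revPerm_symm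

theorem Equiv.Perm.exists_lt_of_ne_one {n : ℕ} {π : Equiv.Perm (Fin n)} (h : π ≠ 1) :
    ∃ k l : Fin n, (l : ℕ) = k + 1 ∧ π l < π k := by
  by_contra! hc
  exact h (eq_one_of_forall_lt fun k l hkl =>
    lt_of_le_of_ne (hc k l hkl) (π.injective.ne (by rw [Ne, Fin.ext_iff]; omega)))

theorem Equiv.Perm.exists_lt_of_ne_revPerm {n : ℕ} {π : Equiv.Perm (Fin n)}
    (h : π ≠ Fin.revPerm) : ∃ k l : Fin n, (l : ℕ) = k + 1 ∧ π k < π l := by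
  by_contra! hc
  exact h (eq_revPerm_of_forall_gt fun k l hkl =>
    lt_of_le_of_ne (hc k l hkl) (π.injective.ne (by rw [Ne, Fin.ext_iff]; omega)))

theorem Equiv.Perm.posInversions_revPerm (n : ℕ) :
    (Fin.revPerm : Equiv.Perm (Fin n)).posInversions = Finset.univ.filter fun p => p.1 < p.2 := by
  ext p
  simp [posInversions]

theorem Equiv.Perm.card_posInversions_le {n : ℕ} (π : Equiv.Perm (Fin n)) :
    π.posInversions.card ≤ (Fin.revPerm : Equiv.Perm (Fin n)).posInversions.card := by
  rw [posInversions_revPerm]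
  exact Finset.card_le_card fun p hp => by
    simpa using (mem_posInversions.mp hp).1

theorem Equiv.Perm.eq_one_or_eq_swap {α : Type*} [DecidableEq α] {ρ : Equiv.Perm α} {a b : α}
    (h : ∀ x, x ≠ a → x ≠ b → ρ x = x) : ρ = 1 ∨ ρ = Equiv.swap a b := by
  have ha : ρ a = a ∨ ρ a = b := by
    by_contra! hc
    exact hc.1 (ρ.injective (h _ hc.1 hc.2))
  have hb : ρ b = a ∨ ρ b = b := by
    by_contra! hc
    exact hc.2 (ρ.injective (h _ hc.1 hc.2))
  by_cases hab : a = b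
  · subst hab
    left
    ext x
    by_cases hx : x = a
    · subst hx; simpa using ha
    · simpa using h x hx hx
  rcases ha with ha | ha
  · left
    have hb : ρ b = b := hb.resolve_left fun hc => hab (ρ.injective (ha.trans hc.symm))
    ext x
    by_cases hx : x = a
    · simp [hx, ha]
    · by_cases hx' : x = b
      · simp [hx', hb]
      · simp [h x hx hx']
  · right
    have hb : ρ b = a := hb.resolve_right fun hc => hab (ρ.injective (ha.trans hc.symm))
    ext x
    by_cases hx : x = a
    · simp [hx, ha]
    · by_cases hx' : x = b
      · simp [hx', hb]
      · rw [h x hx hx', Equiv.swap_apply_of_ne_of_ne hx hx']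

namespace HurwitzWord

variable {n : ℕ}

/-! ### Suffixes determine words -/

theorem prod_drop_ofFn {G : Type*} [Group G] {letter : Fin n → G} {S : ℕ → G}
    (h : ∀ j : Fin n, letter j = S j * (S (j + 1))⁻¹) {j : ℕ} (hj : j ≤ n) :
    ((List.ofFn letter).drop j).prod = S j * (S n)⁻¹ := by
  induction hj using Nat.decreasingInduction with
  | self => simp [List.drop_of_length_le]
  | of_succ j hj ih =>
    rw [List.drop_eq_getElem_cons (by simpa using hj), List.prod_cons, ih]
    simp [h]

theorem suffix_zero (w : HurwitzWord n) : w.suffix 0 = finRotate (n + 1) := by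
  simp [suffix, w.prod_eq]

theorem suffix_self (w : HurwitzWord n) : w.suffix n = 1 := by
  simp [suffix, List.drop_of_length_le]

theorem chain_mul_suffix (w : HurwitzWord n) (k : Fin (n + 1)) :
    w.chain k * w.suffix k = finRotate (n + 1) := by
  rw [chain, suffix, List.prod_take_mul_prod_drop, w.prod_eq]

theorem chain_eq_chain_iff (u v : HurwitzWord n) (k : Fin (n + 1)) :
    u.chain k = v.chain k ↔ u.suffix k = v.suffix k := by
  have hu := u.chain_mul_suffix k
  rw [← v.chain_mul_suffix k] at hu
  constructor <;> intro h <;> rw [h] at hu <;> simpa using hu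

/-- The chain element and the suffix of the same rank multiply to the long cycle, so they determine
each other. The ranks 0 and n never differ, which is why the differing rank l has a predecessor k.
-/
theorem adj_iff {u v : HurwitzWord n} :
    (hurwitzGraph n).Adj u v ↔ ∃ k l : Fin n, (l : ℕ) = k + 1 ∧ u.suffix l ≠ v.suffix l ∧
      ∀ j : ℕ, j ≤ n → j ≠ l → u.suffix j = v.suffix j := by
  constructor
  · rintro ⟨k, hk, huniq⟩
    have hk' : u.suffix k ≠ v.suffix k := fun h => hk ((chain_eq_chain_iff u v k).mpr h)
    have h0 : (k : ℕ) ≠ 0 := fun h => hk' (by rw [h, suffix_zero, suffix_zero])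
    have hn : (k : ℕ) ≠ n := fun h => hk' (by rw [h, suffix_self, suffix_self])
    have hlt := k.isLt
    refine ⟨⟨k - 1, by omega⟩, ⟨k, by omega⟩, by simp; omega, hk', fun j hj hjk => ?_⟩
    by_contra hc
    have := huniq ⟨j, by omega⟩ fun h => hc ((chain_eq_chain_iff u v _).mp h)
    exact hjk (congrArg Fin.val this)
  · rintro ⟨k, l, hkl, hne, h⟩
    refine ⟨l.castSucc, fun hc => hne ((chain_eq_chain_iff u v _).mp hc), fun j hj => ?_⟩
    by_contra hc
    exact hj ((chain_eq_chain_iff u v _).mpr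
      (h j (by omega) fun h' => hc (Fin.ext h')))

theorem exists_suffix_eq {S : ℕ → Equiv.Perm (Fin (n + 1))} (h0 : S 0 = finRotate (n + 1))
    (hn : S n = 1) (hS : ∀ j < n, (S j * (S (j + 1))⁻¹).IsSwap) :
    ∃ w : HurwitzWord n, ∀ j ≤ n, w.suffix j = S j := by
  refine ⟨⟨fun j => S j * (S (j + 1))⁻¹, fun j => hS j j.isLt, ?_⟩, fun j hj => ?_⟩
  · simpa [h0, hn] using prod_drop_ofFn (S := S) (fun _ => rfl) (Nat.zero_le n)
  · have := prod_drop_ofFn (S := S) (fun _ => rfl) hj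
    rwa [hn, inv_one, mul_one] at this

theorem letter_eq (w : HurwitzWord n) (j : Fin n) :
    w.letter j = w.suffix j * (w.suffix (j + 1))⁻¹ := by
  rw [suffix_eq_mul, mul_inv_cancel_right]

/-- The suffix at l enters only the letters at k and l, so only these two need to be checked to be
transpositions. -/
theorem exists_suffix_update (w : HurwitzWord n) {k l : Fin n} (hkl : (l : ℕ) = k + 1)
    {M : Equiv.Perm (Fin (n + 1))} (h1 : (w.suffix k * M⁻¹).IsSwap)
    (h2 : (M * (w.suffix (l + 1))⁻¹).IsSwap) :
    ∃ u : HurwitzWord n, u.suffix l = M ∧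
      ∀ j : ℕ, j ≤ n → j ≠ l → u.suffix j = w.suffix j := by
  have hl := l.isLt
  obtain ⟨u, hu⟩ := exists_suffix_eq (n := n) (S := Function.update w.suffix l M)
    (by rw [Function.update_of_ne (by omega), suffix_zero])
    (by rw [Function.update_of_ne (by omega), suffix_self])
    (fun j hj => by
      by_cases hjl : j = l
      · subst hjl
        rwa [Function.update_self, Function.update_of_ne (by omega)]
      · rw [Function.update_of_ne hjl]
        by_cases hjk : j = k
        · subst hjk
          rwa [hkl, Function.update_self]
        · rw [Function.update_of_ne (by omega)]
          exact w.letter_eq ⟨j, hj⟩ ▸ w.isSwap ⟨j, hj⟩)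
  refine ⟨u, by rw [hu _ hl.le, Function.update_self], fun j hj hjl => ?_⟩
  rw [hu j hj, Function.update_of_ne hjl]

/-! ### The map `φ` along the edges of the Hurwitz graph -/

theorem phi_eq_iff (w : HurwitzWord n) (j i : Fin n) :
    w.phi j = i ↔ w.suffix (j + 1) i.castSucc < w.suffix j i.castSucc := by
  change w.phiFun j = i ↔ i ∈ w.ascents j
  rw [ascents_eq, Set.mem_singleton_iff, eq_comm]

/-- The value of φ at x depends only on the suffixes at x and x + 1, so only its values at k and l
can change. -/
theorem phi_eq_or_eq_mul_swap {u v : HurwitzWord n} {k l : Fin n} (hkl : (l : ℕ) = k + 1)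
    (h : ∀ j : ℕ, j ≤ n → j ≠ l → u.suffix j = v.suffix j) :
    u.phi = v.phi ∨ u.phi = v.phi * Equiv.swap k l := by
  have key : ∀ x, x ≠ k → x ≠ l → (v.phi⁻¹ * u.phi) x = x := by
    intro x hk hl
    rw [Ne, Fin.ext_iff] at hk hl
    rw [Equiv.Perm.mul_apply, Equiv.Perm.inv_eq_iff_eq, phi_eq_iff, h _ (by omega) (by omega),
      h _ (by omega) (by omega), ← phi_eq_iff]
  rcases Equiv.Perm.eq_one_or_eq_swap key with h | h
  · exact Or.inl (inv_mul_eq_one.mp h).symm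
  · exact Or.inr (inv_mul_eq_iff_eq_mul.mp h)

/-! ### Excedances of suffixes -/

theorem suffix_apply_le_of_notMem {w : HurwitzWord n} {i j : Fin n} (h : w.phi j ≠ i) :
    w.suffix j i.castSucc ≤ w.suffix (j + 1) i.castSucc :=
  not_lt.mp fun hc => h ((phi_eq_iff w j i).mpr hc)

/-- As j decreases from n to 0, the image of i under the suffixes starts at i, ends at i + 1, and
increases only at the position φ⁻¹(i). Hence it is at most i before that jump and, by
`lt_suffix_apply`, larger than i after it. -/
theorem suffix_apply_le (w : HurwitzWord n) (i : Fin n) {j : ℕ} (hj : j ≤ n)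
    (h : (w.phi.symm i : ℕ) < j) : w.suffix j i.castSucc ≤ i.castSucc := by
  induction hj using Nat.decreasingInduction with
  | self => simp [suffix_self]
  | of_succ j hj ih =>
    refine le_trans (suffix_apply_le_of_notMem (j := ⟨j, hj⟩) fun hc => ?_) (ih (by omega))
    rw [← hc, Equiv.symm_apply_apply] at h
    simp at h

theorem lt_suffix_apply (w : HurwitzWord n) (i : Fin n) {j : ℕ}
    (h : j ≤ (w.phi.symm i : ℕ)) : i.castSucc < w.suffix j i.castSucc := by
  induction j with
  | zero => rw [suffix_zero]; simp
  | succ j ih =>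
    have hj : j < n := by omega
    refine lt_of_lt_of_le (ih (by omega)) (suffix_apply_le_of_notMem (j := ⟨j, hj⟩) fun hc => ?_)
    rw [← hc, Equiv.symm_apply_apply] at h
    simp at h

/-! ### Neighbours in the Hurwitz graph -/

theorem exists_adj_phi_eq_mul_swap (w : HurwitzWord n) {k l : Fin n} (hkl : (l : ℕ) = k + 1) :
    ∃ u, (hurwitzGraph n).Adj w u ∧ u.phi = w.phi * Equiv.swap k l := by
  set t := w.letter k with ht
  set t' := w.letter l with ht'
  set σ := w.suffix (l + 1) with hσ
  have hsl : w.suffix l = t' * σ := w.suffix_eq_mul l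
  have hsk : w.suffix k = t * (t' * σ) := by rw [← hsl, hkl]; exact w.suffix_eq_mul k
  obtain ⟨a, b, hab, hab'⟩ := w.isSwap k
  obtain ⟨a', b', ha'b, ha'b'⟩ := w.isSwap l
  have conj : ∀ g s : Equiv.Perm (Fin (n + 1)), s.IsSwap → (g * s * g⁻¹).IsSwap := by
    rintro g _ ⟨x, y, hxy, rfl⟩
    exact ⟨g x, g y, g.injective.ne hxy, (Equiv.swap_apply_apply g x y).symm⟩
  have ht2 : t⁻¹ = t := by rw [ht, hab', Equiv.swap_inv]
  have ht2' : t'⁻¹ = t' := by rw [ht', ha'b', Equiv.swap_inv]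
  -- The candidates `u₁` and `u₂` are the two Hurwitz moves, which replace the letters (t, t') by (t
  -- t' t⁻¹, t) and by (t', t' t t').
  obtain ⟨u₁, h₁, h₁'⟩ := w.exists_suffix_update hkl (M := t * σ)
    (by have := conj t t' (w.isSwap l)
        rw [hsk]; convert this using 1; group)
    (by rw [mul_inv_cancel_right]; exact w.isSwap k)
  obtain ⟨u₂, h₂, h₂'⟩ := w.exists_suffix_update hkl (M := t' * t * t' * σ)
    (by have : w.suffix k * (t' * t * t' * σ)⁻¹ = t' := by
          rw [hsk, mul_inv_rev, mul_inv_rev, mul_inv_rev]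
          conv_rhs => rw [← ht2']
          group
        rw [this]; exact w.isSwap l)
    (by rw [mul_inv_cancel_right]
        have := conj t' t (w.isSwap k)
        rwa [ht2'] at this)
  -- If neither move changed φ as desired, the l-th letters t', t and t' t t' of the three words
  -- would all raise the same point v = σ(y). Then t = (v p) and t' = (v q) with p ≠ q, and t' t t'
  -- fixes v.
  by_contra! hc
  have hphi : ∀ u : HurwitzWord n, (∀ j : ℕ, j ≤ n → j ≠ l → u.suffix j = w.suffix j) →
      u.phi = w.phi := by
    intro u hu
    rcases phi_eq_or_eq_mul_swap hkl hu with h | h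
    · exact h
    · refine absurd h (hc u (adj_iff.mpr ⟨k, l, hkl, fun hs => ?_, fun j hj hjl =>
        (hu j hj hjl).symm⟩))
      have : u.phi = w.phi := by
        refine Equiv.ext fun j => ?_
        rw [phi_eq_iff]
        have hall : ∀ j : ℕ, j ≤ n → u.suffix j = w.suffix j := fun j hj => by
          by_cases hjl : j = l
          · rw [hjl, hs]
          · exact hu j hj hjl
        rw [hall _ (by omega), hall _ (by omega), ← phi_eq_iff]
      rw [this] at h
      have h1 : Equiv.swap k l = 1 := by simpa using h.symm
      have : k = l := by simpa using h1
      omega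
  set y := w.phi l with hy
  have e0 : σ y.castSucc < (t' * σ) y.castSucc := hsl ▸ (w.phi_eq_iff l y).mp rfl
  have e1 : σ y.castSucc < (t * σ) y.castSucc := by
    have := (u₁.phi_eq_iff l y).mp (by rw [hphi u₁ h₁'])
    rwa [h₁, h₁' _ (by omega) (by omega)] at this
  have e2 : σ y.castSucc < (t' * t * t' * σ) y.castSucc := by
    have := (u₂.phi_eq_iff l y).mp (by rw [hphi u₂ h₂'])
    rwa [h₂, h₂' _ (by omega) (by omega)] at this
  have htt : t ≠ t' := by
    -- If t = t', the two letters cancel and the suffix at k is σ. But y has not yet jumped in σ,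
    -- and it has jumped in the suffix at k.
    intro h
    have h3 : w.suffix k = σ := by rw [hsk, ← h, ← mul_assoc]; nth_rw 1 [← ht2]; simp
    have e3 := w.suffix_apply_le y (j := l + 1) (by omega) (by simp [hy])
    have e4 := w.lt_suffix_apply y (j := k) (by simp [hy]; omega)
    rw [h3] at e4
    exact absurd e4 (not_lt.mpr e3)
  simp only [Equiv.Perm.mul_apply] at e0 e1 e2
  set v := σ y.castSucc
  have f1 := e0.ne'
  have f2 := e1.ne'
  have f3 := e2.ne'
  rw [ht] at f2 f3
  rw [ht'] at f1 f3
  rw [ht, ht', hab', ha'b'] at htt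
  rw [hab'] at f2 f3
  rw [ha'b'] at f1 f3
  have aux : ∀ (x y v : Fin (n + 1)), Equiv.swap x y v ≠ v → ∃ p, p ≠ v ∧
      Equiv.swap x y = Equiv.swap v p := by
    intro x y v h
    by_cases hx : v = x
    · subst hx
      exact ⟨y, fun h' => h (by rw [h', Equiv.swap_self]; rfl), rfl⟩
    · by_cases hy : v = y
      · subst hy
        exact ⟨x, fun h' => hx h'.symm, Equiv.swap_comm _ _⟩
      · exact absurd (Equiv.swap_apply_of_ne_of_ne hx hy) h
  obtain ⟨p, hp, hp'⟩ := aux _ _ _ f2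
  obtain ⟨q, hq, hq'⟩ := aux _ _ _ f1
  rw [hp', hq'] at htt f3
  have hpq : q ≠ p := fun h => htt (by rw [h])
  rw [Equiv.swap_apply_left, Equiv.swap_apply_of_ne_of_ne hq hpq, Equiv.swap_apply_right] at f3
  exact f3 rfl

theorem card_posInversions_le_of_adj {u v : HurwitzWord n} (h : (hurwitzGraph n).Adj u v) :
    v.phi.posInversions.card ≤ u.phi.posInversions.card + 1 := by
  obtain ⟨k, l, hkl, -, h⟩ := adj_iff.mp h
  rcases phi_eq_or_eq_mul_swap hkl (fun j hj hjl => (h j hj hjl).symm) with h | h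
  · rw [h]
    omega
  · rw [h]
    exact u.phi.card_posInversions_mul_swap_le hkl

theorem card_posInversions_le_add_length {u v : HurwitzWord n} (p : (hurwitzGraph n).Walk u v) :
    v.phi.posInversions.card ≤ u.phi.posInversions.card + p.length := by
  induction p with
  | nil => simp
  | cons h p ih =>
    have := card_posInversions_le_of_adj h
    rw [SimpleGraph.Walk.length_cons]
    omega

/-- The suffix at j sends i < j to at most i and i ≥ j to more than i. By injectivity, going upwards
from 0 it must fix each i < j, and going downwards from n - 1 it must send each i ≥ j to i + 1. So
the j-th letter sends j to j + 1. -/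
theorem eq_base_of_phi_eq_one {w : HurwitzWord n} (h : w.phi = 1) : w = base n := by
  have hsymm : ∀ i, w.phi.symm i = i := fun i => by rw [h]; rfl
  have hlow : ∀ m : ℕ, ∀ i : Fin n, (i : ℕ) = m → ∀ j : ℕ, j ≤ n → m < j →
      w.suffix j i.castSucc = i.castSucc := by
    intro m
    induction m using Nat.strong_induction_on with
    | _ m ih =>
      intro i hi j hj hmj
      have hle := w.suffix_apply_le i hj (by rw [hsymm]; omega)
      by_contra hne
      have hlt := lt_of_le_of_ne hle hne
      have hx : (w.suffix j i.castSucc : ℕ) < i := hlt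
      have := ih (w.suffix j i.castSucc) (by omega) ⟨w.suffix j i.castSucc, by omega⟩ rfl j hj
        (by omega)
      have h2 := (w.suffix j).injective (this : w.suffix j (w.suffix j i.castSucc) = _)
      exact hne h2
  have hhigh : ∀ m : ℕ, ∀ i : Fin n, (i : ℕ) + m + 1 = n → ∀ j : ℕ, j ≤ i →
      w.suffix j i.castSucc = i.succ := by
    intro m
    induction m using Nat.strong_induction_on with
    | _ m ih =>
      intro i hi j hj
      have hlt := w.lt_suffix_apply i (j := j) (by rw [hsymm]; exact hj)
      have hlt' : (i : ℕ) < w.suffix j i.castSucc := hlt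
      have hub := (w.suffix j i.castSucc).isLt
      by_contra hne
      have hne' : (w.suffix j i.castSucc : ℕ) ≠ i + 1 := fun h => hne (Fin.ext (by simpa using h))
      obtain ⟨x, hx⟩ : ∃ x : ℕ, (w.suffix j i.castSucc : ℕ) = x + 1 :=
        ⟨(w.suffix j i.castSucc : ℕ) - 1, by omega⟩
      have hxn : x < n := by omega
      have hxi : (i : ℕ) < x := by omega
      have := ih (n - x - 1) (by omega) ⟨x, hxn⟩ (by simp only; omega) j (by simp only; omega)
      have h2 : w.suffix j (Fin.castSucc ⟨x, hxn⟩) = w.suffix j i.castSucc := by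
        rw [this]; exact Fin.ext (by simp [hx])
      have h3 := congrArg Fin.val ((w.suffix j).injective h2)
      simp at h3
      omega
  refine HurwitzWord.ext (funext fun j => ?_)
  have h1 := hlow j j rfl (j + 1) (by omega) (by omega)
  have h2 := hhigh (n - j - 1) j (by omega) j le_rfl
  rw [suffix_eq_mul, Equiv.Perm.mul_apply, h1] at h2
  obtain ⟨a, b, hab, ht⟩ := w.isSwap j
  rw [ht] at h2 ⊢
  change _ = Equiv.swap j.castSucc j.succ
  have hne : j.castSucc ≠ j.succ := Fin.castSucc_lt_succ.ne
  rw [Equiv.swap_apply_def] at h2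
  split_ifs at h2 with h3 h4
  · rw [h2, h3]
  · rw [h2, h4, Equiv.swap_comm]
  · exact absurd h2 hne

/-! ### Distances from the base point and maximal elements -/

theorem phi_base (n : ℕ) : (base n).phi = 1 := by
  -- φ of the base point is not computed directly: removing inversions one by one through neighbours
  -- reaches some word with φ = 1, and that word can only be the base point.
  obtain ⟨w, hw⟩ : ∃ w : HurwitzWord n, w.phi = 1 := by
    have key : ∀ (m : ℕ) (v : HurwitzWord n), v.phi.posInversions.card = m →
        ∃ w : HurwitzWord n, w.phi = 1 := by
      intro m
      induction m with
      | zero =>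
        intro v hv
        refine ⟨v, by_contra fun hne => ?_⟩
        obtain ⟨k, l, hkl, hlt⟩ := Equiv.Perm.exists_lt_of_ne_one hne
        have := v.phi.card_posInversions_mul_swap_of_gt hkl hlt
        omega
      | succ m ih =>
        intro v hv
        have hne : v.phi ≠ 1 := fun h => by
          rw [h, Equiv.Perm.posInversions_one] at hv
          simp at hv
        obtain ⟨k, l, hkl, hlt⟩ := Equiv.Perm.exists_lt_of_ne_one hne
        obtain ⟨u, -, hu⟩ := v.exists_adj_phi_eq_mul_swap hkl
        have hc := v.phi.card_posInversions_mul_swap_of_gt hkl hlt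
        rw [← hu] at hc
        exact ih u (by omega)
    exact key _ (base n) rfl
  rw [← eq_base_of_phi_eq_one hw, hw]

theorem exists_walk_length_eq_card_posInversions (v : HurwitzWord n) :
    ∃ p : (hurwitzGraph n).Walk (base n) v, p.length = v.phi.posInversions.card := by
  generalize hm : v.phi.posInversions.card = m
  induction m generalizing v with
  | zero =>
    have : v = base n := eq_base_of_phi_eq_one <| by_contra fun hne => by
      obtain ⟨k, l, hkl, hlt⟩ := Equiv.Perm.exists_lt_of_ne_one hne
      have := v.phi.card_posInversions_mul_swap_of_gt hkl hlt
      omega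
    subst this
    exact ⟨SimpleGraph.Walk.nil, rfl⟩
  | succ m ih =>
    have hne : v.phi ≠ 1 := fun h => by
      rw [h, Equiv.Perm.posInversions_one] at hm
      simp at hm
    obtain ⟨k, l, hkl, hlt⟩ := Equiv.Perm.exists_lt_of_ne_one hne
    obtain ⟨u, hadj, hu⟩ := v.exists_adj_phi_eq_mul_swap hkl
    have hc := v.phi.card_posInversions_mul_swap_of_gt hkl hlt
    rw [← hu] at hc
    obtain ⟨p, hp⟩ := ih u (by omega)
    exact ⟨p.concat hadj.symm, by rw [SimpleGraph.Walk.length_concat, hp]⟩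

theorem dist_base (v : HurwitzWord n) :
    (hurwitzGraph n).dist (base n) v = v.phi.posInversions.card := by
  obtain ⟨p, hp⟩ := v.exists_walk_length_eq_card_posInversions
  refine le_antisymm (hp ▸ SimpleGraph.dist_le p) ?_
  obtain ⟨p', hp'⟩ := p.reachable.exists_walk_length_eq_dist
  have := card_posInversions_le_add_length p'
  rwa [phi_base, Equiv.Perm.posInversions_one, Finset.card_empty, zero_add, hp'] at this

theorem isMax_iff_phi_eq_revPerm (w : HurwitzWord n) : IsMax w ↔ w.phi = Fin.revPerm := by
  classical
  constructor
  · intro hmax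
    by_contra hne
    obtain ⟨k, l, hkl, hlt⟩ := Equiv.Perm.exists_lt_of_ne_revPerm hne
    obtain ⟨u, hadj, hu⟩ := w.exists_adj_phi_eq_mul_swap hkl
    have hc := w.phi.card_posInversions_mul_swap_of_lt hkl hlt
    rw [← hu] at hc
    obtain ⟨p, hp⟩ := w.exists_walk_length_eq_card_posInversions
    have hwu : w ≤ u := ⟨p.concat hadj, by
      rw [SimpleGraph.Walk.length_concat, dist_base, hp, hc], by
      rw [SimpleGraph.Walk.support_concat]; simp⟩
    obtain ⟨p', hp', hmem⟩ := hmax hwu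
    have h1 := p'.length_takeUntil_le_length hmem
    have h2 := SimpleGraph.dist_le (p'.takeUntil u hmem)
    rw [dist_base] at hp' h2
    omega
  · rintro hw b ⟨p, hp, hmem⟩
    have hwb : w = b := by
      by_contra hne
      have h1 := SimpleGraph.Walk.length_takeUntil_lt_length hmem hne
      have h2 := SimpleGraph.dist_le (p.takeUntil w hmem)
      have h3 := b.phi.card_posInversions_le
      rw [dist_base] at hp h2
      rw [← hw] at h3
      omega
    subst hwb
    exact ⟨p, hp, hmem⟩

end HurwitzWord

/-! ### Words of transpositions of natural numbers -/

/-- The product of the transpositions `f (lo + n - 1), …, f (lo + 1), f lo`, where a pair `(a, b)`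
stands for the transposition of `a` and `b`. -/
def swapProd (f : ℕ → ℕ × ℕ) (lo : ℕ) : ℕ → Equiv.Perm ℕ
  | 0 => 1
  | n + 1 => Equiv.swap (f (lo + n)).1 (f (lo + n)).2 * swapProd f lo n

/-- The word `f lo, …, f (lo + n - 1)` factors the cycle `(lo, lo + 1, …, lo + n)` in such a way
that its `i`-th transposition raises the image of `lo + i`. -/
structure IsRisingWord (f : ℕ → ℕ × ℕ) (lo n : ℕ) : Prop where
  le_fst : ∀ i < n, lo ≤ (f (lo + i)).1
  fst_lt_snd : ∀ i < n, (f (lo + i)).1 < (f (lo + i)).2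
  snd_le : ∀ i < n, (f (lo + i)).2 ≤ lo + n
  apply_eq_fst : ∀ i < n, swapProd f lo i (lo + i) = (f (lo + i)).1
  apply_eq_succ : ∀ i < n, swapProd f lo n (lo + i) = lo + i + 1
  apply_last : swapProd f lo n (lo + n) = lo

theorem swapProd_add (f : ℕ → ℕ × ℕ) (lo m n : ℕ) :
    swapProd f lo (m + n) = swapProd f (lo + m) n * swapProd f lo m := by
  induction n with
  | zero => simp [swapProd]
  | succ n ih => rw [← add_assoc, swapProd, swapProd, ih, mul_assoc, add_assoc]

theorem swapProd_apply_of_forall_ne {f : ℕ → ℕ × ℕ} {lo n x : ℕ}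
    (h : ∀ i < n, x ≠ (f (lo + i)).1 ∧ x ≠ (f (lo + i)).2) : swapProd f lo n x = x := by
  induction n with
  | zero => rfl
  | succ n ih =>
    rw [swapProd, Equiv.Perm.mul_apply, ih fun i hi => h i (by omega),
      Equiv.swap_apply_of_ne_of_ne (h n (by omega)).1 (h n (by omega)).2]

theorem swapProd_apply_mem {f : ℕ → ℕ × ℕ} {lo n : ℕ} {s : Set ℕ}
    (h : ∀ i < n, (f (lo + i)).1 ∈ s ↔ (f (lo + i)).2 ∈ s) (x : ℕ) :
    swapProd f lo n x ∈ s ↔ x ∈ s := by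
  induction n with
  | zero => rfl
  | succ n ih =>
    rw [swapProd, Equiv.Perm.mul_apply, ← ih fun i hi => h i (by omega)]
    have := h n (by omega)
    rw [Equiv.swap_apply_def]
    split_ifs with h1 h2
    · rw [h1]; exact this.symm
    · rw [h2]; exact this
    · rfl

theorem swapProd_invariant {f : ℕ → ℕ × ℕ} {lo n : ℕ} {α : Type*} {g : ℕ → α}
    (h : ∀ i < n, g (f (lo + i)).1 = g (f (lo + i)).2) (x : ℕ) :
    g (swapProd f lo n x) = g x := by
  induction n with
  | zero => rfl
  | succ n ih =>
    rw [swapProd, Equiv.Perm.mul_apply, ← ih fun i hi => h i (by omega)]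
    have := h n (by omega)
    rw [Equiv.swap_apply_def]
    split_ifs with h1 h2
    · rw [h1]; exact this.symm
    · rw [h2]; exact this
    · rfl

/-- A system of `n` equations `g (a i) = g (b i)`, one of which is replaced by `g v = 0`, on `n + 1`
unknowns has a nonzero solution. -/
theorem exists_function_of_edges (a b : ℕ → ℕ) (lo v : ℕ) {n k : ℕ} (hk : k < n) :
    ∃ g : ℕ → ℚ, (∃ x ∈ Set.Icc lo (lo + n), g x ≠ 0) ∧ g v = 0 ∧
      ∀ i < n, i ≠ k → g (a i) = g (b i) := by
  -- Extension by zero outside the window [lo, lo + n], so that the equations make sense wherever `a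
  -- i`, `b i` and `v` lie.
  let E : (Fin (n + 1) → ℚ) →ₗ[ℚ] (ℕ → ℚ) :=
    { toFun := fun x m => if h : lo ≤ m ∧ m ≤ lo + n then x ⟨m - lo, by omega⟩ else 0
      map_add' := fun x y => by ext m; by_cases h : lo ≤ m ∧ m ≤ lo + n <;> simp [h]
      map_smul' := fun c x => by ext m; by_cases h : lo ≤ m ∧ m ≤ lo + n <;> simp [h] }
  let L : (Fin (n + 1) → ℚ) →ₗ[ℚ] (Fin n → ℚ) := LinearMap.pi fun i =>
    if (i : ℕ) = k then LinearMap.proj v ∘ₗ E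
    else LinearMap.proj (a i) ∘ₗ E - LinearMap.proj (b i) ∘ₗ E
  have hker : LinearMap.ker L ≠ ⊥ := LinearMap.ker_ne_bot_of_finrank_lt (by simp)
  obtain ⟨x, hx, hx0⟩ := (Submodule.ne_bot_iff _).mp hker
  have hL : ∀ i, L x i = 0 := fun i => congrFun (LinearMap.mem_ker.mp hx) i
  refine ⟨E x, ?_, ?_, fun i hi hik => ?_⟩
  · obtain ⟨j, hj⟩ := Function.ne_iff.mp hx0
    refine ⟨lo + j, ⟨by omega, by omega⟩, ?_⟩
    have : E x (lo + j) = x j := by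
      have hj' : (j : ℕ) ≤ n := by omega
      simp [E, hj']
    rwa [this]
  · simpa [L] using hL ⟨k, hk⟩
  · have := hL ⟨i, hi⟩
    simpa [L, hik, sub_eq_zero] using this

theorem IsRisingWord.split {f : ℕ → ℕ × ℕ} {lo n : ℕ} (h : IsRisingWord f lo (n + 1)) :
    ∃ k ≤ n, f (lo + k) = (lo, lo + n + 1) ∧ IsRisingWord f lo k ∧
      IsRisingWord f (lo + k + 1) (n - k) := by
  classical
  have hex : ∃ k, k < n + 1 ∧ (f (lo + k)).2 = lo + n + 1 := by
    by_contra! hc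
    have := swapProd_apply_of_forall_ne (f := f) (lo := lo) (n := n + 1) (x := lo + n + 1)
      fun i hi => ⟨by have := h.fst_lt_snd i hi; have := h.snd_le i hi; omega, (hc i hi).symm⟩
    have := h.apply_last
    simp only [← add_assoc] at *
    omega
  obtain ⟨k, ⟨hkn, hk⟩, hmin⟩ : ∃ k, (k < n + 1 ∧ (f (lo + k)).2 = lo + n + 1) ∧
      ∀ i < k, (f (lo + i)).2 ≠ lo + n + 1 :=
    ⟨Nat.find hex, Nat.find_spec hex, fun i hi hc =>
      Nat.find_min hex hi ⟨by have := (Nat.find_spec hex).1; omega, hc⟩⟩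
  have hfix : swapProd f lo k (lo + n + 1) = lo + n + 1 := by
    refine swapProd_apply_of_forall_ne fun i hi => ⟨?_, (hmin i hi).symm⟩
    have := h.fst_lt_snd i (by omega)
    have := h.snd_le i (by omega)
    omega
  set N := lo + n + 1 with hN
  set P := swapProd f lo k with hP
  -- `Q m` is the product of the first `k + 1 + m` transpositions without the `k`-th one.
  set Q : ℕ → Equiv.Perm ℕ := fun m => swapProd f (lo + k + 1) m * P with hQ
  -- The k-th letter is (P(lo + k), P(N)), so moving it to the right of P turns it into the
  -- transposition of lo + k and N. Consequently Q d is the long cycle cut into the cycles on [lo,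
  -- lo + k] and [lo + k + 1, N].
  have hPQ : ∀ m, swapProd f lo (k + 1 + m) = Q m * Equiv.swap (lo + k) N := by
    intro m
    rw [swapProd_add, swapProd, ← add_assoc, hQ, mul_assoc, hk]
    have := Equiv.mul_swap_eq_swap_mul P (lo + k) N
    rw [hfix, h.apply_eq_fst k hkn] at this
    rw [← this, ← mul_assoc]
  have hQval : ∀ m x, x ≠ lo + k → x ≠ N → swapProd f lo (k + 1 + m) x = Q m x := by
    intro m x h1 h2
    rw [hPQ, Equiv.Perm.mul_apply, Equiv.swap_apply_of_ne_of_ne h1 h2]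
  obtain ⟨d, hd⟩ : ∃ d, n = k + d := ⟨n - k, by omega⟩
  have hfull : swapProd f lo (k + 1 + d) = swapProd f lo (n + 1) := by rw [hd]; congr 1; omega
  have hQsucc : ∀ x, lo ≤ x → x < N → x ≠ lo + k → Q d x = x + 1 := by
    intro x h1 h2 h3
    rw [← hQval d x h3 h2.ne, hfull]
    have := h.apply_eq_succ (x - lo) (by omega)
    rwa [show lo + (x - lo) = x by omega] at this
  have hQk : Q d (lo + k) = lo := by
    have := h.apply_last
    rw [← hfull, hPQ, Equiv.Perm.mul_apply, ← add_assoc, ← hN, Equiv.swap_apply_right] at this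
    exact this
  have hQN : Q d N = lo + k + 1 := by
    have := h.apply_eq_succ k hkn
    rw [← hfull, hPQ, Equiv.Perm.mul_apply, Equiv.swap_apply_left] at this
    exact this
  -- The remaining n letters are edges on n + 2 points, so some nonzero g with g(N) = 0 is constant
  -- along each edge. It is invariant under Q d, hence zero on the upper block and a nonzero
  -- constant on the lower one; an edge between the blocks would contradict this.
  have hblock : ∀ i < n + 1, i ≠ k → ((f (lo + i)).1 ≤ lo + k ↔ (f (lo + i)).2 ≤ lo + k) := by
    obtain ⟨g, ⟨x₀, hx₀, hgx₀⟩, hgN, hg⟩ := exists_function_of_edges (fun i => (f (lo + i)).1)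
      (fun i => (f (lo + i)).2) lo N hkn
    have hinv : ∀ x, g (Q d x) = g x := by
      intro x
      rw [hQ, Equiv.Perm.mul_apply, swapProd_invariant (g := g), hP, swapProd_invariant (g := g)]
      · exact fun i hi => hg i (by omega) (by omega)
      · intro i hi
        have := hg (k + 1 + i) (by omega) (by omega)
        simpa only [← add_assoc] using this
    have hlow : ∀ i ≤ k, g (lo + i) = g lo := by
      intro i
      induction i with
      | zero => intro; rfl
      | succ i ih =>
        intro hi
        rw [← ih (by omega), ← hinv (lo + i), hQsucc _ (by omega) (by omega) (by omega), add_assoc]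
    have hhigh : ∀ i ≤ d, g (lo + k + 1 + i) = 0 := by
      intro i
      induction i with
      | zero => intro; rw [← hgN, ← hinv N, hQN]
      | succ i ih =>
        intro hi
        rw [← ih (by omega), ← hinv (lo + k + 1 + i), hQsucc _ (by omega) (by omega) (by omega)]
        rfl
    have hlow' : ∀ x, lo ≤ x → x ≤ lo + k → g x = g lo := fun x h1 h2 => by
      rw [← hlow (x - lo) (by omega)]; congr 1; omega
    have hhigh' : ∀ x, lo + k < x → x ≤ N → g x = 0 := fun x h1 h2 => by
      rw [← hhigh (x - (lo + k + 1)) (by omega)]; congr 1; omega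
    have hg0 : g lo ≠ 0 := by
      rcases le_or_gt x₀ (lo + k) with hx | hx
      · rwa [hlow' x₀ hx₀.1 hx] at hgx₀
      · exact absurd (hhigh' x₀ hx hx₀.2) hgx₀
    have hiff : ∀ x, lo ≤ x → x ≤ N → (x ≤ lo + k ↔ g x ≠ 0) := fun x h1 h2 =>
      ⟨fun hx => by rwa [hlow' x h1 hx], fun hx => not_lt.mp fun hc => hx (hhigh' x hc h2)⟩
    intro i hi hik
    have h1 := h.le_fst i hi
    have h2 := h.fst_lt_snd i hi
    have h3 := h.snd_le i hi
    rw [hiff _ h1 (by omega), hiff _ (by omega) (by omega)]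
    exact not_congr (by rw [show g (f (lo + i)).1 = g (f (lo + i)).2 from hg i hi hik])
  -- The first entry is the image of lo + i under letters that preserve the blocks, so it lies in
  -- the block of lo + i.
  have hblock1 : ∀ i < k, (f (lo + i)).2 ≤ lo + k := by
    intro i hi
    rw [← hblock i (by omega) (by omega), ← h.apply_eq_fst i (by omega)]
    exact (swapProd_apply_mem (s := Set.Iic (lo + k))
      (fun j hj => hblock j (by omega) (by omega)) (lo + i)).mpr (by simp; omega)
  have hval2 : ∀ i < d, Q i (lo + k + 1 + i) = (f (lo + k + 1 + i)).1 := by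
    intro i hi
    rw [← hQval i _ (by omega) (by omega)]
    have := h.apply_eq_fst (k + 1 + i) (by omega)
    simpa only [← add_assoc] using this
  have hPhigh : ∀ x, lo + k < x → P x = x := by
    intro x hx
    refine swapProd_apply_of_forall_ne fun i hi => ?_
    have := hblock1 i hi
    have := h.fst_lt_snd i (by omega)
    constructor <;> omega
  have hblock2' : ∀ i < d, ((f (lo + k + 1 + i)).1 ≤ lo + k ↔ (f (lo + k + 1 + i)).2 ≤ lo + k) := by
    intro i hi
    have := hblock (k + 1 + i) (by omega) (by omega)
    simpa only [← add_assoc] using this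
  have hval2' : ∀ i < d, swapProd f (lo + k + 1) i (lo + k + 1 + i) = (f (lo + k + 1 + i)).1 := by
    intro i hi
    rw [← hval2 i hi, hQ, Equiv.Perm.mul_apply, hPhigh _ (by omega)]
  have hblock2 : ∀ i < d, lo + k < (f (lo + k + 1 + i)).1 := by
    intro i hi
    rw [← not_le, ← hval2' i hi]
    exact (swapProd_apply_mem (s := Set.Iic (lo + k))
      (fun j hj => hblock2' j (by omega)) (lo + k + 1 + i)).not.mpr (by simp; omega)
  have hlt2 : ∀ i < d, (f (lo + k + 1 + i)).1 < (f (lo + k + 1 + i)).2 := fun i hi => by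
    have := h.fst_lt_snd (k + 1 + i) (by omega)
    simpa only [← add_assoc] using this
  -- The later letters move only points of the upper block. In particular P(lo + k) = lo, which
  -- identifies the k-th letter.
  have hPlow : ∀ x ≤ lo + k, P x = Q d x := by
    intro x hx
    rw [hQ, Equiv.Perm.mul_apply]
    refine (swapProd_apply_of_forall_ne fun i hi => ?_).symm
    have hPx : P x ≤ lo + k := (swapProd_apply_mem (s := Set.Iic (lo + k))
      (fun j hj => hblock j (by omega) (by omega)) x).mpr hx
    have := hblock2 i hi
    have := hlt2 i hi
    constructor <;> omega
  refine ⟨k, by omega, ?_, ⟨fun i hi => h.le_fst i (by omega), fun i hi => h.fst_lt_snd i (by omega),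
    hblock1, fun i hi => h.apply_eq_fst i (by omega), fun i hi => ?_, ?_⟩, ?_⟩
  · refine Prod.ext ?_ hk
    rw [← h.apply_eq_fst k hkn, ← hP, hPlow _ le_rfl, hQk]
  · rw [← hP, hPlow _ (by omega), hQsucc _ (by omega) (by omega) (by omega)]
  · rw [← hP, hPlow _ le_rfl, hQk]
  · rw [show n - k = d by omega]
    refine ⟨fun i hi => hblock2 i hi, hlt2, fun i hi => ?_, hval2', fun i hi => ?_, ?_⟩
    · have := h.snd_le (k + 1 + i) (by omega)
      simp only [← add_assoc] at this
      omega
    · rw [← hQsucc (lo + k + 1 + i) (by omega) (by omega) (by omega), hQ, Equiv.Perm.mul_apply,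
        hPhigh _ (by omega)]
    · rw [show lo + k + 1 + d = N by omega]
      nth_rw 2 [← hQN]
      rw [hQ, Equiv.Perm.mul_apply, hPhigh N (by omega)]

theorem IsRisingWord.apply_of_lt {f : ℕ → ℕ × ℕ} {lo n x : ℕ} (h : IsRisingWord f lo n)
    (hx : x < lo) : swapProd f lo n x = x :=
  swapProd_apply_of_forall_ne fun i hi => by
    have := h.le_fst i hi
    have := h.fst_lt_snd i hi
    constructor <;> omega

theorem IsRisingWord.apply_of_gt {f : ℕ → ℕ × ℕ} {lo n x : ℕ} (h : IsRisingWord f lo n)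
    (hx : lo + n < x) : swapProd f lo n x = x :=
  swapProd_apply_of_forall_ne fun i hi => by
    have := h.snd_le i hi
    have := h.fst_lt_snd i hi
    constructor <;> omega

theorem IsRisingWord.join {f : ℕ → ℕ × ℕ} {lo k d : ℕ} (hk : f (lo + k) = (lo, lo + k + d + 1))
    (h1 : IsRisingWord f lo k) (h2 : IsRisingWord f (lo + k + 1) d) :
    IsRisingWord f lo (k + d + 1) := by
  have hcases : ∀ {p : ℕ → Prop}, (∀ i < k, p i) → p k → (∀ i < d, p (k + 1 + i)) →
      ∀ i < k + d + 1, p i := by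
    intro p ha hb hc i hi
    rcases lt_trichotomy i k with hik | rfl | hik
    · exact ha i hik
    · exact hb
    · obtain ⟨j, rfl⟩ : ∃ j, i = k + 1 + j := ⟨i - (k + 1), by omega⟩
      exact hc j (by omega)
  have hprod : ∀ i, swapProd f lo (k + 1 + i) =
      swapProd f (lo + k + 1) i * (Equiv.swap lo (lo + k + d + 1) * swapProd f lo k) := by
    intro i
    rw [swapProd_add, swapProd, hk, ← add_assoc]
  have hprod' : swapProd f lo (k + d + 1) =
      swapProd f (lo + k + 1) d * (Equiv.swap lo (lo + k + d + 1) * swapProd f lo k) := by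
    rw [← hprod]; congr 1; omega
  refine ⟨hcases h1.le_fst (by rw [hk]) fun i hi => ?_,
    hcases h1.fst_lt_snd (by rw [hk]; simp only; omega) fun i hi => ?_,
    hcases (fun i hi => (h1.snd_le i hi).trans (by omega)) (by rw [hk]; simp only; omega)
      fun i hi => ?_,
    hcases h1.apply_eq_fst (by rw [hk, h1.apply_last]) fun i hi => ?_,
    hcases (fun i hi => ?_) ?_ fun i hi => ?_, ?_⟩
  · have := h2.le_fst i hi
    simp only [← add_assoc]
    omega
  · simpa only [← add_assoc] using h2.fst_lt_snd i hi
  · have := h2.snd_le i hi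
    simp only [← add_assoc] at *
    omega
  · rw [hprod, ← add_assoc, ← add_assoc, ← h2.apply_eq_fst i hi, Equiv.Perm.mul_apply,
      Equiv.Perm.mul_apply, h1.apply_of_gt (by omega),
      Equiv.swap_apply_of_ne_of_ne (by omega) (by omega)]
  · rw [hprod', Equiv.Perm.mul_apply, Equiv.Perm.mul_apply, h1.apply_eq_succ i hi,
      Equiv.swap_apply_of_ne_of_ne (by omega) (by omega), h2.apply_of_lt (by omega)]
  · rw [hprod', Equiv.Perm.mul_apply, Equiv.Perm.mul_apply, h1.apply_last,
      Equiv.swap_apply_left, show lo + k + d + 1 = lo + k + 1 + d by omega, h2.apply_last]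
  · rw [hprod', Equiv.Perm.mul_apply, Equiv.Perm.mul_apply, h1.apply_of_gt (by omega),
      Equiv.swap_apply_of_ne_of_ne (by omega) (by omega), ← add_assoc, ← add_assoc,
      h2.apply_eq_succ i hi]
  · rw [hprod', Equiv.Perm.mul_apply, Equiv.Perm.mul_apply, h1.apply_of_gt (by omega),
      ← add_assoc, ← add_assoc, Equiv.swap_apply_right, h2.apply_of_lt (by omega)]

/-! ### Rising words and binary trees -/

namespace BinaryTree

/-- The letters `f lo, …, f (lo + n - 1)`, `n` the number of nodes of the tree, are the nodes of the
tree in symmetric order: the letter of a node is `(a, b)` if `a, …, b - 1` are the indices of the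
nodes of the subtree below it. -/
def IsCodedBy (f : ℕ → ℕ × ℕ) : BinaryTree Unit → ℕ → Prop
  | nil, _ => True
  | node _ l r, lo => f (lo + l.numNodes) = (lo, lo + l.numNodes + r.numNodes + 1) ∧
      IsCodedBy f l lo ∧ IsCodedBy f r (lo + l.numNodes + 1)

theorem IsCodedBy.congr {f g : ℕ → ℕ × ℕ} {T : BinaryTree Unit} {lo : ℕ} (h : IsCodedBy f T lo)
    (hfg : ∀ i < T.numNodes, g (lo + i) = f (lo + i)) : IsCodedBy g T lo := by
  induction T generalizing lo with
  | nil => trivial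
  | node _ l r ihl ihr =>
    simp only [numNodes] at hfg
    refine ⟨(hfg _ (by omega)).trans h.1, ihl h.2.1 fun i hi => hfg i (by omega),
      ihr h.2.2 fun i hi => ?_⟩
    have := hfg (l.numNodes + 1 + i) (by omega)
    simpa only [← add_assoc] using this

theorem exists_isCodedBy (T : BinaryTree Unit) (lo : ℕ) : ∃ f, IsCodedBy f T lo := by
  induction T generalizing lo with
  | nil => exact ⟨fun _ => (0, 0), trivial⟩
  | node _ l r ihl ihr =>
    obtain ⟨f, hf⟩ := ihl lo
    obtain ⟨g, hg⟩ := ihr (lo + l.numNodes + 1)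
    refine ⟨fun i => if i < lo + l.numNodes then f i else if i = lo + l.numNodes then
      (lo, lo + l.numNodes + r.numNodes + 1) else g i, by simp, hf.congr fun i hi => ?_,
      hg.congr fun i hi => ?_⟩
    · exact if_pos (by omega)
    · rw [if_neg (by omega), if_neg (by omega)]

theorem IsCodedBy.eq {f g : ℕ → ℕ × ℕ} {T : BinaryTree Unit} {lo : ℕ} (hf : IsCodedBy f T lo)
    (hg : IsCodedBy g T lo) {i : ℕ} (hi : i < T.numNodes) : f (lo + i) = g (lo + i) := by
  induction T generalizing lo i with
  | nil => simp [numNodes] at hi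
  | node _ l r ihl ihr =>
    simp only [numNodes] at hi
    rcases lt_trichotomy i l.numNodes with h | rfl | h
    · exact ihl hf.2.1 hg.2.1 h
    · exact hf.1.trans hg.1.symm
    · have := ihr hf.2.2 hg.2.2 (i := i - (l.numNodes + 1)) (by omega)
      rwa [show lo + l.numNodes + 1 + (i - (l.numNodes + 1)) = lo + i by omega] at this

theorem IsCodedBy.isRisingWord {f : ℕ → ℕ × ℕ} {T : BinaryTree Unit} {lo : ℕ}
    (h : IsCodedBy f T lo) : IsRisingWord f lo T.numNodes := by
  induction T generalizing lo with
  | nil => constructor <;> simp [numNodes, swapProd]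
  | node _ l r ihl ihr => exact (ihl h.2.1).join h.1 (ihr h.2.2)

/-- The root is located by its letter, whose second entry is maximal: letters of a left subtree have
smaller second entries. So the left subtrees have equal sizes, and induction applies. -/
theorem IsCodedBy.unique {f : ℕ → ℕ × ℕ} {T T' : BinaryTree Unit} {lo : ℕ}
    (h : IsCodedBy f T lo) (h' : IsCodedBy f T' lo) (hn : T.numNodes = T'.numNodes) : T = T' := by
  have key : ∀ {l r l' r' : BinaryTree Unit} {lo : ℕ},
      f (lo + l.numNodes) = (lo, lo + l.numNodes + r.numNodes + 1) → IsCodedBy f l' lo →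
      l.numNodes + r.numNodes = l'.numNodes + r'.numNodes → ¬ l.numNodes < l'.numNodes := by
    intro l r l' r' lo hf hl hlr hlt
    have := hl.isRisingWord.snd_le _ hlt
    rw [hf] at this
    simp only at this
    omega
  induction T generalizing T' lo with
  | nil =>
    cases T' with
    | nil => rfl
    | node _ l' r' => simp [numNodes] at hn
  | node _ l r ihl ihr =>
    cases T' with
    | nil => simp [numNodes] at hn
    | node _ l' r' =>
      simp only [numNodes, add_left_inj] at hn
      have hl : l.numNodes = l'.numNodes := le_antisymm
        (not_lt.mp (key h'.1 h.2.1 hn.symm)) (not_lt.mp (key h.1 h'.2.1 hn))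
      have h2 := h'.2.2
      rw [← hl] at h2
      rw [ihl h.2.1 h'.2.1 hl, ihr h.2.2 h2 (by omega)]

end BinaryTree

theorem IsRisingWord.exists_isCodedBy {f : ℕ → ℕ × ℕ} {n lo : ℕ} (h : IsRisingWord f lo n) :
    ∃ T : BinaryTree Unit, T.numNodes = n ∧ T.IsCodedBy f lo := by
  induction n using Nat.strong_induction_on generalizing lo with
  | _ n ih =>
    cases n with
    | zero => exact ⟨.nil, rfl, trivial⟩
    | succ n =>
      obtain ⟨k, hk, hf, hl, hr⟩ := h.split
      obtain ⟨l, hl, hl'⟩ := ih k (by omega) hl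
      obtain ⟨r, hr, hr'⟩ := ih (n - k) (by omega) hr
      refine ⟨.node () l r, by simp only [BinaryTree.numNodes]; omega, ?_, hl', ?_⟩
      · rw [hl, hr, hf]
        congr 1
        omega
      · rwa [hl]

/-! ### Statistics on pairs of letters -/

/-- The sum of `c (f i) (f j)` over the pairs of indices `lo ≤ i < j < lo + n`. -/
def pairSum (c : ℕ × ℕ → ℕ × ℕ → ℕ) (f : ℕ → ℕ × ℕ) (lo n : ℕ) : ℕ :=
  ∑ j ∈ Finset.range n, ∑ i ∈ Finset.range j, c (f (lo + i)) (f (lo + j))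

namespace BinaryTree

/-- The sum over all nodes of `α x + β y + γ x y`, where `x` and `y` are the sizes of the two
subtrees of the node. -/
def sizeStat (α β γ : ℕ) : BinaryTree Unit → ℕ
  | nil => 0
  | node _ l r => sizeStat α β γ l + sizeStat α β γ r + α * l.numNodes + β * r.numNodes +
      γ * (l.numNodes * r.numNodes)

/-- Pairs not within one subtree of the root are (left, root), (root, right) or (left, right), with
intervals nested, nested the other way, or disjoint. The three hypotheses give `c` the constant
values α, β, γ in these cases. -/
theorem IsCodedBy.pairSum_eq {c : ℕ × ℕ → ℕ × ℕ → ℕ} {α β γ : ℕ}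
    (hα : ∀ {x y a b}, x ≤ a → a < b → b < y → c (a, b) (x, y) = α)
    (hβ : ∀ {x y a b}, x < a → a < b → b ≤ y → c (x, y) (a, b) = β)
    (hγ : ∀ {x y a b}, x < y → y < a → a < b → c (x, y) (a, b) = γ)
    {f : ℕ → ℕ × ℕ} {T : BinaryTree Unit} {lo : ℕ} (h : IsCodedBy f T lo) :
    pairSum c f lo T.numNodes = sizeStat α β γ T := by
  induction T generalizing lo with
  | nil => rfl
  | node _ l r ihl ihr =>
    have hl := h.2.1.isRisingWord
    have hr := h.2.2.isRisingWord
    have h1 : ∀ i ∈ Finset.range l.numNodes, c (f (lo + i)) (f (lo + l.numNodes)) = α := by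
      intro i hi
      rw [Finset.mem_range] at hi
      rw [h.1]
      have := hl.snd_le i hi
      exact hα (hl.le_fst i hi) (hl.fst_lt_snd i hi) (by omega)
    have h2 : ∀ j < r.numNodes,
        c (f (lo + l.numNodes)) (f (lo + l.numNodes + 1 + j)) = β := by
      intro j hj
      rw [h.1]
      have := hr.le_fst j hj
      have := hr.snd_le j hj
      exact hβ (by omega) (hr.fst_lt_snd j hj) (by omega)
    have h3 : ∀ j < r.numNodes, ∀ i ∈ Finset.range l.numNodes,
        c (f (lo + i)) (f (lo + l.numNodes + 1 + j)) = γ := by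
      intro j hj i hi
      rw [Finset.mem_range] at hi
      have := hl.snd_le i hi
      have := hr.le_fst j hj
      exact hγ (hl.fst_lt_snd i hi) (by omega) (hr.fst_lt_snd j hj)
    have h4 : ∀ j ∈ Finset.range r.numNodes,
        ∑ i ∈ Finset.range (l.numNodes + 1 + j),
          c (f (lo + i)) (f (lo + (l.numNodes + 1 + j))) =
        γ * l.numNodes + β + ∑ i ∈ Finset.range j,
          c (f (lo + l.numNodes + 1 + i)) (f (lo + l.numNodes + 1 + j)) := by
      intro j hj
      rw [Finset.mem_range] at hj
      simp only [← add_assoc]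
      rw [Finset.sum_range_add, Finset.sum_range_succ, h2 j hj, Finset.sum_congr rfl (h3 j hj)]
      simp only [← add_assoc, Finset.sum_const, Finset.card_range, smul_eq_mul, mul_comm γ]
    have h5 : numNodes (node () l r) = l.numNodes + 1 + r.numNodes := by
      simp only [numNodes]; omega
    change pairSum c f lo (numNodes (node () l r)) = _
    rw [h5, pairSum, Finset.sum_range_add, Finset.sum_range_succ, Finset.sum_congr rfl h1,
      Finset.sum_congr rfl h4, Finset.sum_add_distrib]
    have e1 := ihl h.2.1
    have e2 := ihr h.2.2
    rw [pairSum] at e1 e2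
    rw [e1, e2]
    simp only [Finset.sum_const, Finset.card_range, smul_eq_mul, sizeStat]
    ring

theorem sum_treesOfNumNodesEq {R : Type*} [CommRing R] {W : BinaryTree Unit → R} {C : ℕ → R}
    {v : ℕ → ℕ → R} (hnil : W nil = 1)
    (hnode : ∀ l r, W (node () l r) = v l.numNodes r.numNodes * W l * W r) (h0 : C 0 = 1)
    (hC : ∀ n, C (n + 1) = ∑ k : Fin (n + 1), v k (n - k) * C k * C (n - k)) (n : ℕ) :
    ∑ T ∈ treesOfNumNodesEq n, W T = C n := by
  induction n using Nat.strong_induction_on with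
  | _ n ih =>
    cases n with
    | zero => simp [hnil, h0]
    | succ n =>
      rw [treesOfNumNodesEq_succ, Finset.sum_biUnion, hC,
        Finset.Nat.sum_antidiagonal_eq_sum_range_succ_mk,
        Finset.sum_range]
      · refine Finset.sum_congr rfl fun k _ => ?_
        rw [← ih k (by omega), ← ih (n - k) (by omega), Finset.sum_map, Finset.sum_product,
          mul_assoc, Finset.sum_mul_sum, Finset.mul_sum]
        refine Finset.sum_congr rfl fun l hl => ?_
        rw [Finset.mul_sum]
        refine Finset.sum_congr rfl fun r hr => ?_
        rw [mem_treesOfNumNodesEq] at hl hr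
        change W (node () l r) = _
        rw [hnode, hl, hr, mul_assoc]
      · rintro ⟨i, j⟩ _ ⟨i', j'⟩ _ hne
        rw [Function.onFun, Finset.disjoint_left]
        intro T hT hT'
        simp only [Finset.mem_map, Finset.mem_product, mem_treesOfNumNodesEq, Prod.exists] at hT hT'
        obtain ⟨l, r, ⟨rfl, rfl⟩, rfl⟩ := hT
        obtain ⟨l', r', ⟨rfl, rfl⟩, h⟩ := hT'
        injection h with _ h1 h2
        subst h1 h2
        exact hne rfl

theorem sum_pow_sizeStat_eq_qtCatalan {R : Type*} [CommRing R] (q t : R) (n : ℕ) :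
    ∑ T ∈ treesOfNumNodesEq n, q ^ sizeStat 1 0 0 T * t ^ sizeStat 0 1 0 T = qtCatalan q t n :=
  sum_treesOfNumNodesEq (v := fun k m => q ^ k * t ^ m) (by simp [sizeStat])
    (fun l r => by simp only [sizeStat, one_mul, zero_mul, add_zero, pow_add]; ring)
    (by rw [qtCatalan]) (fun n => by rw [qtCatalan]) n

theorem sum_pow_sizeStat_eq_carlitzRiordan {R : Type*} [CommRing R] (q : R) (n : ℕ) :
    ∑ T ∈ treesOfNumNodesEq n, q ^ sizeStat 0 1 1 T = carlitzRiordan q n :=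
  sum_treesOfNumNodesEq (v := fun k m => q ^ ((k + 1) * m)) (by simp [sizeStat])
    (fun l r => by
      simp only [sizeStat, one_mul, zero_mul, add_zero]
      rw [← pow_add, ← pow_add]
      congr 1
      ring)
    (by rw [carlitzRiordan]) (fun n => by rw [carlitzRiordan]) n

end BinaryTree

/-- The two recurrences match because binom(k + m + 1, 2) = k + binom(k, 2) + binom(m, 2) + (k +
1)m. -/
theorem qtCatalan_one_right {R : Type*} [CommRing R] (q : Rˣ) (n : ℕ) :
    qtCatalan (q : R) 1 n = (q : R) ^ n.choose 2 * carlitzRiordan ((q⁻¹ : Rˣ) : R) n := by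
  induction n using Nat.strong_induction_on with
  | _ n ih =>
    cases n with
    | zero => simp [qtCatalan, carlitzRiordan]
    | succ n =>
      rw [qtCatalan, carlitzRiordan, Finset.mul_sum]
      refine Finset.sum_congr rfl fun k _ => ?_
      obtain ⟨m, hm⟩ : ∃ m, n = k + m := ⟨n - k, by omega⟩
      have hm' : n - k = m := by omega
      rw [hm', ih k (by omega), ih m (by omega), one_pow, mul_one]
      have h1 : ∀ a b : ℕ, (a + b + 1).choose 2 = a + a.choose 2 + b.choose 2 + (a + 1) * b := by
        intro a b
        induction b with
        | zero => simp [Nat.choose_succ_succ']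
        | succ b ihb =>
          rw [← add_assoc, Nat.choose_succ_succ' (a + b + 1) 1, ihb, Nat.choose_succ_succ' b 1]
          simp only [Nat.choose_one_right]
          ring
      have h2 : (q : R) ^ (((k : ℕ) + 1) * m) * ((q⁻¹ : Rˣ) : R) ^ (((k : ℕ) + 1) * m) = 1 := by
        rw [← mul_pow, Units.mul_inv, one_pow]
      have h3 : (n + 1).choose 2 = k + (k : ℕ).choose 2 + m.choose 2 + (k + 1) * m := by
        rw [← h1]; congr 2
      rw [h3, pow_add, pow_add, pow_add]
      linear_combination (-(q : R) ^ (k : ℕ) * (q : R) ^ (k : ℕ).choose 2 * (q : R) ^ m.choose 2 *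
        carlitzRiordan ((q⁻¹ : Rˣ) : R) k * carlitzRiordan ((q⁻¹ : Rˣ) : R) m) * h2

namespace HurwitzWord

variable {n : ℕ}

/-! ### Maximal elements as rising words -/

/-- `f i` is the pair of letters interchanged by the `i`-th factor from the right of `w`. -/
def IsCodedBy (w : HurwitzWord n) (f : ℕ → ℕ × ℕ) : Prop :=
  ∀ i : Fin n, ∃ a b : Fin (n + 1), a < b ∧ w.letter i.rev = Equiv.swap a b ∧ f i = ((a : ℕ), (b : ℕ))

theorem exists_isCodedBy (w : HurwitzWord n) : ∃ f, w.IsCodedBy f := by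
  have h : ∀ i : Fin n, ∃ a b : Fin (n + 1), a < b ∧ w.letter i.rev = Equiv.swap a b := by
    intro i
    obtain ⟨a, b, hab, h⟩ := w.isSwap i.rev
    rcases lt_or_gt_of_ne hab with hlt | hlt
    · exact ⟨a, b, hlt, h⟩
    · exact ⟨b, a, hlt, by rw [h, Equiv.swap_comm]⟩
  choose a b hab h using h
  exact ⟨fun i => if hi : i < n then (a ⟨i, hi⟩, b ⟨i, hi⟩) else (0, 0),
    fun i => ⟨a i, b i, hab i, h i, by simp⟩⟩

theorem IsCodedBy.eq {w w' : HurwitzWord n} {f : ℕ → ℕ × ℕ} (h : w.IsCodedBy f)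
    (h' : w'.IsCodedBy f) : w = w' := by
  refine HurwitzWord.ext (funext fun j => ?_)
  obtain ⟨a, b, -, hw, hf⟩ := h j.rev
  obtain ⟨a', b', -, hw', hf'⟩ := h' j.rev
  rw [hf, Prod.mk.injEq, ← Fin.ext_iff, ← Fin.ext_iff] at hf'
  rw [Fin.rev_rev] at hw hw'
  rw [hw, hw', hf'.1, hf'.2]

theorem IsCodedBy.congr {w : HurwitzWord n} {f g : ℕ → ℕ × ℕ} (h : w.IsCodedBy f)
    (hfg : ∀ i < n, g i = f i) : w.IsCodedBy g := fun i => by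
  obtain ⟨a, b, hab, hw, hf⟩ := h i
  exact ⟨a, b, hab, hw, (hfg i i.isLt).trans hf⟩

theorem val_prod_drop_ofFn {letter : Fin n → Equiv.Perm (Fin (n + 1))} {f : ℕ → ℕ × ℕ}
    (h : ∀ i : Fin n, ∃ a b : Fin (n + 1), letter i.rev = Equiv.swap a b ∧ f i = ((a : ℕ), (b : ℕ)))
    {m : ℕ} (hm : m ≤ n) (x : Fin (n + 1)) :
    (((List.ofFn letter).drop (n - m)).prod x : ℕ) = swapProd f 0 m x := by
  induction m generalizing x with
  | zero => simp [List.drop_of_length_le, swapProd]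
  | succ m ih =>
    have hlt : n - (m + 1) < n := by omega
    obtain ⟨a, b, hl, hf⟩ := h ⟨m, by omega⟩
    rw [List.drop_eq_getElem_cons (by simpa using hlt), List.prod_cons, swapProd, zero_add,
      Equiv.Perm.mul_apply, Equiv.Perm.mul_apply, ← ih (by omega),
      show n - (m + 1) + 1 = n - m by omega, hf, List.getElem_ofFn]
    change (letter (Fin.rev ⟨m, by omega⟩) _ : ℕ) = _
    rw [hl]
    exact (Fin.val_injective.swap_apply _ _ _).symm

theorem IsCodedBy.val_suffix {w : HurwitzWord n} {f : ℕ → ℕ × ℕ} (h : w.IsCodedBy f) {m : ℕ}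
    (hm : m ≤ n) (x : Fin (n + 1)) : (w.suffix (n - m) x : ℕ) = swapProd f 0 m x :=
  val_prod_drop_ofFn (fun i => by
    obtain ⟨a, b, -, hw, hf⟩ := h i
    exact ⟨a, b, hw, hf⟩) hm x

theorem phi_eq_revPerm_iff {w : HurwitzWord n} :
    w.phi = Fin.revPerm ↔ ∀ i : Fin n,
      w.suffix (n - i) i.castSucc < w.suffix (n - (i + 1)) i.castSucc := by
  have key : ∀ i : Fin n, w.phi i.rev = i ↔
      w.suffix (n - i) i.castSucc < w.suffix (n - (i + 1)) i.castSucc := by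
    intro i
    rw [phi_eq_iff, Fin.val_rev, show n - (i + 1) + 1 = n - i by omega]
  constructor
  · intro h i
    rw [← key, h]
    simp
  · intro h
    ext j
    have := (key j.rev).mpr (h j.rev)
    rw [Fin.rev_rev] at this
    rw [this]
    rfl

theorem IsCodedBy.isRisingWord {w : HurwitzWord n} {f : ℕ → ℕ × ℕ} (h : w.IsCodedBy f)
    (hw : w.phi = Fin.revPerm) : IsRisingWord f 0 n := by
  have hfull : ∀ x : Fin (n + 1), swapProd f 0 n x = finRotate (n + 1) x := fun x => by
    rw [← h.val_suffix le_rfl, Nat.sub_self, suffix_zero]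
  have hrot : ∀ i : Fin n, finRotate (n + 1) i.castSucc = i.succ := fun i => by simp
  refine ⟨fun i hi => Nat.zero_le _, fun i hi => ?_, fun i hi => ?_, fun i hi => ?_,
    fun i hi => ?_, ?_⟩
  · obtain ⟨a, b, hab, -, hf⟩ := h ⟨i, hi⟩
    simp only at hf
    rw [zero_add, hf]
    exact hab
  · obtain ⟨a, b, hab, -, hf⟩ := h ⟨i, hi⟩
    simp only at hf
    rw [zero_add, hf]
    simp only
    omega
  · obtain ⟨a, b, hab, -, hf⟩ := h ⟨i, hi⟩
    have hlt := phi_eq_revPerm_iff.mp hw ⟨i, hi⟩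
    rw [Fin.lt_def, h.val_suffix (by simp only; omega), h.val_suffix (by simp only; omega)] at hlt
    simp only [Fin.val_castSucc] at hlt hf
    rw [zero_add, hf]
    -- A transposition (a b) with a < b raises only a, so the image being raised is a.
    rw [swapProd, Equiv.Perm.mul_apply, zero_add, hf, Equiv.swap_apply_def] at hlt
    rw [Fin.lt_def] at hab
    simp only at hlt ⊢
    split_ifs at hlt with h1 h2
    · exact h1
    · omega
    · omega
  · have := hfull (Fin.castSucc ⟨i, hi⟩)
    simp only [Fin.val_castSucc] at this
    rw [hrot] at this
    rw [zero_add, this]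
    rfl
  · have := hfull (Fin.last n)
    rw [Fin.val_last, finRotate_last] at this
    rw [zero_add, this]
    rfl

end HurwitzWord

theorem IsRisingWord.exists_hurwitzWord {f : ℕ → ℕ × ℕ} {n : ℕ} (h : IsRisingWord f 0 n) :
    ∃ w : HurwitzWord n, w.IsCodedBy f ∧ w.phi = Fin.revPerm := by
  have hle := h.snd_le
  have hlt := h.fst_lt_snd
  simp only [zero_add] at hle hlt
  let a : Fin n → Fin (n + 1) := fun i =>
    ⟨(f i).1, by have := hle i i.isLt; have := hlt i i.isLt; omega⟩
  let b : Fin n → Fin (n + 1) := fun i => ⟨(f i).2, by have := hle i i.isLt; omega⟩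
  have hab : ∀ i, a i < b i := fun i => hlt i i.isLt
  have hprod : (List.ofFn fun j : Fin n => Equiv.swap (a j.rev) (b j.rev)).prod =
      finRotate (n + 1) := by
    ext x
    have := HurwitzWord.val_prod_drop_ofFn (f := f)
      (letter := fun j : Fin n => Equiv.swap (a j.rev) (b j.rev))
      (fun i => ⟨a i, b i, by simp only [Fin.rev_rev], rfl⟩) le_rfl x
    rw [Nat.sub_self, List.drop_zero] at this
    rw [this]
    induction x using Fin.lastCases with
    | last =>
      have := h.apply_last
      rw [zero_add] at this
      rw [Fin.val_last, this, finRotate_last]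
      rfl
    | cast i =>
      have := h.apply_eq_succ i i.isLt
      rw [zero_add] at this
      rw [Fin.val_castSucc, this, show finRotate (n + 1) i.castSucc = i.succ by simp]
      rfl
  let w : HurwitzWord n := ⟨_, fun j => ⟨a j.rev, b j.rev, (hab _).ne, rfl⟩, hprod⟩
  have hw : w.IsCodedBy f := fun i => ⟨a i, b i, hab i, by simp only [w, Fin.rev_rev], rfl⟩
  refine ⟨w, hw, HurwitzWord.phi_eq_revPerm_iff.mpr fun i => ?_⟩
  have hi := h.apply_eq_fst i i.isLt
  rw [zero_add] at hi
  rw [Fin.lt_def, hw.val_suffix (by omega), hw.val_suffix (by omega), Fin.val_castSucc, swapProd,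
    Equiv.Perm.mul_apply, hi, zero_add, Equiv.swap_apply_left]
  exact hlt i i.isLt

namespace HurwitzWord

variable {n : ℕ}

/-! ### Inversions of the maximal elements -/

theorem swap_eq_swap_iff {α : Type*} [LinearOrder α] {a b c d : α} (hab : a < b) (hcd : c < d) :
    Equiv.swap a b = Equiv.swap c d ↔ a = c ∧ b = d := by
  constructor
  · intro h
    have h1 : Equiv.swap c d a = b := by rw [← h, Equiv.swap_apply_left]
    rw [Equiv.swap_apply_def] at h1
    split_ifs at h1 with h2 h3
    · exact ⟨h2, h1.symm⟩
    · subst h1 h3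
      exact absurd hab (not_lt.mpr hcd.le)
    · exact absurd h1 hab.ne
  · rintro ⟨rfl, rfl⟩
    rfl

theorem inversions_eq_of_phi_eq_revPerm {w : HurwitzWord n} (hw : w.phi = Fin.revPerm) :
    w.inversions = {p | p.1 < p.2} := by
  ext p
  simp only [inversions, hw, Fin.revPerm_symm, Fin.revPerm_apply, Fin.rev_lt_rev, Set.mem_ofPred_eq,
    and_self]

theorem ncard_pairs_eq_pairSum (r : ℕ × ℕ → ℕ × ℕ → Prop) [DecidableRel r] (f : ℕ → ℕ × ℕ) :
    {p : Fin n × Fin n | p.1 < p.2 ∧ r (f p.1) (f p.2)}.ncard =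
      pairSum (fun x y => if r x y then 1 else 0) f 0 n := by
  have h1 : {p : Fin n × Fin n | p.1 < p.2 ∧ r (f p.1) (f p.2)} =
      ((Finset.univ.filter fun p : Fin n × Fin n => p.1 < p.2 ∧ r (f p.1) (f p.2) :
        Finset (Fin n × Fin n)) : Set (Fin n × Fin n)) := by
    ext p; simp
  rw [h1, Set.ncard_coe_finset, Finset.card_filter, Fintype.sum_prod_type_right, pairSum,
    Finset.sum_range]
  refine Finset.sum_congr rfl fun j _ => ?_
  have h2 : ∀ i : Fin n, (if i < j ∧ r (f i) (f j) then 1 else 0) =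
      if (i : ℕ) < j then (if r (f i) (f j) then 1 else 0) else 0 := by
    intro i
    rw [ite_and]
    rfl
  simp only [h2, zero_add]
  rw [Fin.sum_univ_eq_sum_range (fun i => if i < (j : ℕ) then
    (if r (f i) (f j) then 1 else 0) else 0) n, ← Finset.sum_filter]
  refine Finset.sum_congr ?_ fun _ _ => rfl
  ext i
  simp only [Finset.mem_filter, Finset.mem_range]
  omega

section Inversions

variable {w : HurwitzWord n} {f : ℕ → ℕ × ℕ}

theorem IsCodedBy.exists_letterAt (h : w.IsCodedBy f) (hw : w.phi = Fin.revPerm) (i : Fin n) :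
    ∃ a b : Fin (n + 1), a < b ∧ w.letterAt i = Equiv.swap a b ∧ f i = ((a : ℕ), (b : ℕ)) := by
  obtain ⟨a, b, hab, hl, hf⟩ := h i
  refine ⟨a, b, hab, ?_, hf⟩
  rw [letterAt, hw, Fin.revPerm_symm, Fin.revPerm_apply, hl]

/-- Every pair i < j is an inversion here, and the two patterns in the definition are the cases of
equal and of distinct left endpoints. `IsCodedBy.invL_eq` is the mirror image, with right endpoints.
-/
theorem IsCodedBy.invR_eq (h : w.IsCodedBy f) (hw : w.phi = Fin.revPerm) :
    w.invR = {p | p.1 < p.2 ∧ (f p.2).1 ≤ (f p.1).1 ∧ (f p.1).2 < (f p.2).2} := by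
  ext p
  obtain ⟨a, b, hab, hl, hf⟩ := h.exists_letterAt hw p.1
  obtain ⟨a', b', hab', hl', hf'⟩ := h.exists_letterAt hw p.2
  rw [invR, Set.mem_ofPred_eq, Set.mem_ofPred_eq, inversions_eq_of_phi_eq_revPerm hw,
    Set.mem_ofPred_eq, hl, hl', hf, hf']
  refine and_congr_right fun _ => ?_
  simp only [Fin.val_fin_le, Fin.val_fin_lt]
  constructor
  · rintro (⟨x, y, z, hxy, hyz, h1, h2⟩ | ⟨x, y, z, u, hxy, hyz, hzu, h1, h2⟩)
    · rw [swap_eq_swap_iff hab' (hxy.trans hyz)] at h1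
      rw [swap_eq_swap_iff hab hxy] at h2
      rw [h1.1, h1.2, h2.1, h2.2]
      exact ⟨le_rfl, hyz⟩
    · rw [swap_eq_swap_iff hab' (hxy.trans (hyz.trans hzu))] at h1
      rw [swap_eq_swap_iff hab hyz] at h2
      rw [h1.1, h1.2, h2.1, h2.2]
      exact ⟨hxy.le, hzu⟩
  · rintro ⟨h1, h2⟩
    rcases h1.eq_or_lt with h1 | h1
    · subst h1
      exact Or.inl ⟨_, _, _, hab, h2, rfl, rfl⟩
    · exact Or.inr ⟨_, _, _, _, h1, hab, h2, rfl, rfl⟩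

theorem IsCodedBy.invL_eq (h : w.IsCodedBy f) (hw : w.phi = Fin.revPerm) :
    w.invL = {p | p.1 < p.2 ∧ (f p.1).1 < (f p.2).1 ∧ (f p.2).2 ≤ (f p.1).2} := by
  ext p
  obtain ⟨a, b, hab, hl, hf⟩ := h.exists_letterAt hw p.1
  obtain ⟨a', b', hab', hl', hf'⟩ := h.exists_letterAt hw p.2
  rw [invL, Set.mem_ofPred_eq, Set.mem_ofPred_eq, inversions_eq_of_phi_eq_revPerm hw,
    Set.mem_ofPred_eq, hl, hl', hf, hf']
  refine and_congr_right fun _ => ?_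
  simp only [Fin.val_fin_le, Fin.val_fin_lt]
  constructor
  · rintro (⟨x, y, z, hxy, hyz, h1, h2⟩ | ⟨x, y, z, u, hxy, hyz, hzu, h1, h2⟩)
    · rw [swap_eq_swap_iff hab' hyz] at h1
      rw [swap_eq_swap_iff hab (hxy.trans hyz)] at h2
      rw [h1.1, h1.2, h2.1, h2.2]
      exact ⟨hxy, le_rfl⟩
    · rw [swap_eq_swap_iff hab' hyz] at h1
      rw [swap_eq_swap_iff hab (hxy.trans (hyz.trans hzu))] at h2
      rw [h1.1, h1.2, h2.1, h2.2]
      exact ⟨hxy, hzu.le⟩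
  · rintro ⟨h1, h2⟩
    rcases h2.eq_or_lt with h2 | h2
    · subst h2
      exact Or.inl ⟨_, _, _, h1, hab', rfl, rfl⟩
    · exact Or.inr ⟨_, _, _, _, h1, hab', h2, rfl, rfl⟩

theorem IsCodedBy.invN_eq (h : w.IsCodedBy f) (hw : w.phi = Fin.revPerm) :
    w.invN = {p | p.1 < p.2 ∧ (f p.1).2 < (f p.2).1} := by
  ext p
  obtain ⟨a, b, hab, hl, hf⟩ := h.exists_letterAt hw p.1
  obtain ⟨a', b', hab', hl', hf'⟩ := h.exists_letterAt hw p.2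
  rw [invN, Set.mem_ofPred_eq, Set.mem_ofPred_eq, inversions_eq_of_phi_eq_revPerm hw,
    Set.mem_ofPred_eq, hl, hl', hf, hf']
  refine and_congr_right fun _ => ?_
  simp only [Fin.val_fin_lt]
  constructor
  · rintro ⟨x, y, z, u, hxy, hyz, hzu, h1, h2⟩
    rw [swap_eq_swap_iff hab' hzu] at h1
    rw [swap_eq_swap_iff hab hxy] at h2
    rw [h1.1, h2.2]
    exact hyz
  · exact fun h1 => ⟨_, _, _, _, hab, h1, hab', rfl, rfl⟩

variable {T : BinaryTree Unit}

theorem IsCodedBy.ncard_invR (h : w.IsCodedBy f) (hw : w.phi = Fin.revPerm)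
    (hT : T.IsCodedBy f 0) (hn : T.numNodes = n) : w.invR.ncard = T.sizeStat 1 0 0 := by
  subst hn
  rw [h.invR_eq hw, ncard_pairs_eq_pairSum (fun x y => y.1 ≤ x.1 ∧ x.2 < y.2)]
  refine hT.pairSum_eq (fun h1 h2 h3 => if_pos ⟨h1, h3⟩) (fun h1 h2 h3 => if_neg ?_)
    (fun h1 h2 h3 => if_neg ?_) <;> simp only <;> omega

theorem IsCodedBy.ncard_invL (h : w.IsCodedBy f) (hw : w.phi = Fin.revPerm)
    (hT : T.IsCodedBy f 0) (hn : T.numNodes = n) : w.invL.ncard = T.sizeStat 0 1 0 := by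
  subst hn
  rw [h.invL_eq hw, ncard_pairs_eq_pairSum (fun x y => x.1 < y.1 ∧ y.2 ≤ x.2)]
  refine hT.pairSum_eq (fun h1 h2 h3 => if_neg ?_) (fun h1 h2 h3 => if_pos ⟨h1, h3⟩)
    (fun h1 h2 h3 => if_neg ?_) <;> simp only <;> omega

theorem IsCodedBy.ncard_invL_union_invN (h : w.IsCodedBy f) (hw : w.phi = Fin.revPerm)
    (hT : T.IsCodedBy f 0) (hn : T.numNodes = n) :
    (w.invL ∪ w.invN).ncard = T.sizeStat 0 1 1 := by
  subst hn
  have hu : w.invL ∪ w.invN = {p | p.1 < p.2 ∧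
      (((f p.1).1 < (f p.2).1 ∧ (f p.2).2 ≤ (f p.1).2) ∨ (f p.1).2 < (f p.2).1)} := by
    rw [h.invL_eq hw, h.invN_eq hw]
    ext p
    simp only [Set.mem_union, Set.mem_ofPred_eq]
    tauto
  rw [hu, ncard_pairs_eq_pairSum (fun x y => (x.1 < y.1 ∧ y.2 ≤ x.2) ∨ x.2 < y.1)]
  refine hT.pairSum_eq (fun h1 h2 h3 => if_neg ?_) (fun h1 h2 h3 => if_pos (Or.inl ⟨h1, h3⟩))
    (fun h1 h2 h3 => if_pos (Or.inr h2))
  simp only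
  omega

end Inversions

/-- A sum over the maximal elements is a sum over the binary trees with `n` nodes. -/
theorem sum_maxElements_eq {R : Type*} [CommRing R] {F : HurwitzWord n → R}
    {G : BinaryTree Unit → R}
    (hFG : ∀ (w : HurwitzWord n) (f : ℕ → ℕ × ℕ) (T : BinaryTree Unit), w.IsCodedBy f →
      w.phi = Fin.revPerm → T.IsCodedBy f 0 → T.numNodes = n → F w = G T) :
    ∑ w ∈ maxElements n, F w = ∑ T ∈ BinaryTree.treesOfNumNodesEq n, G T := by
  have hmem : ∀ w : HurwitzWord n, w ∈ maxElements n ↔ w.phi = Fin.revPerm := fun w => by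
    classical
    simp [maxElements, isMax_iff_phi_eq_revPerm]
  have hex : ∀ w : HurwitzWord n, w ∈ maxElements n →
      ∃ (f : ℕ → ℕ × ℕ) (T : BinaryTree Unit), w.IsCodedBy f ∧ T.numNodes = n ∧ T.IsCodedBy f 0 := by
    intro w hw
    obtain ⟨f, hf⟩ := w.exists_isCodedBy
    obtain ⟨T, hT⟩ := (hf.isRisingWord ((hmem w).mp hw)).exists_isCodedBy
    exact ⟨f, T, hf, hT⟩
  choose f T hf hn hT using hex
  refine Finset.sum_bij T (fun w hw => BinaryTree.mem_treesOfNumNodesEq.mpr (hn w hw))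
    (fun w hw w' hw' h => ?_) (fun S hS => ?_)
    (fun w hw => hFG w _ _ (hf w hw) ((hmem w).mp hw) (hT w hw) (hn w hw))
  · refine (hf w hw).eq ((hf w' hw').congr fun i hi => ?_)
    have h1 := hT w hw
    rw [h] at h1
    simpa using h1.eq (hT w' hw') (by rwa [hn])
  · rw [BinaryTree.mem_treesOfNumNodesEq] at hS
    obtain ⟨g, hg⟩ := S.exists_isCodedBy 0
    have hrise := hg.isRisingWord
    rw [hS] at hrise
    obtain ⟨w, hw, hphi⟩ := hrise.exists_hurwitzWord
    have hw' := (hmem w).mpr hphi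
    refine ⟨w, hw', ?_⟩
    have hfw := hf w hw'
    -- The tree of `w` was chosen through some coding of `w`, possibly not `g`. Two codings of the
    -- same word agree below n, since a transposition determines its ordered pair of entries.
    refine BinaryTree.IsCodedBy.unique ((hT w hw').congr fun i hi => ?_) hg
      ((hn w hw').trans hS.symm)
    rw [hn] at hi
    rw [zero_add]
    obtain ⟨a, b, hab, hl, hfi⟩ := hw ⟨i, hi⟩
    obtain ⟨a', b', hab', hl', hfi'⟩ := hfw ⟨i, hi⟩
    rw [hl, swap_eq_swap_iff hab hab'] at hl'
    simp only at hfi hfi'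
    rw [hfi, hfi', hl'.1, hl'.2]

end HurwitzWord

theorem mainTheorem6 {R : Type*} [CommRing R] (n : ℕ) (hn : 0 < n) :
    (∀ q t : R,
      ∑ w ∈ HurwitzWord.maxElements n, q ^ w.invR.ncard * t ^ w.invL.ncard =
        qtCatalan q t n) ∧
    (∀ q : Rˣ,
      ∑ w ∈ HurwitzWord.maxElements n, (q : R) ^ w.invR.ncard =
        (q : R) ^ n.choose 2 * carlitzRiordan ((q⁻¹ : Rˣ) : R) n) ∧
    (∀ q : R,
      ∑ w ∈ HurwitzWord.maxElements n, q ^ (w.invL ∪ w.invN).ncard =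
        carlitzRiordan q n) := by
  have main : ∀ q t : R, ∑ w ∈ HurwitzWord.maxElements n, q ^ w.invR.ncard * t ^ w.invL.ncard =
      qtCatalan q t n := fun q t => by
    rw [← BinaryTree.sum_pow_sizeStat_eq_qtCatalan]
    exact HurwitzWord.sum_maxElements_eq fun w f T hf hw hT hn => by
      rw [hf.ncard_invR hw hT hn, hf.ncard_invL hw hT hn]
  refine ⟨main, fun q => ?_, fun q => ?_⟩
  · rw [← qtCatalan_one_right, ← main]
    simp
  · rw [← BinaryTree.sum_pow_sizeStat_eq_carlitzRiordan]
    exact HurwitzWord.sum_maxElements_eq fun w f T hf hw hT hn => by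
      rw [hf.ncard_invL_union_invN hw hT hn]
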